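/- **Conventions.** All fields have characteristic $\ne 2$ and quadratic forms are nondegenerate unless stated otherwise. $i_W(q)$ is the Witt index of $q$ (the largest number of hyperbolic planes that split off orthogonally), $\langle a_1,\dots,a_m\rangle$ is the diagonal form $a_1X_1^2+\dots+a_mX_m^2$, and $\langle\langle a_1,\dots,a_m\rangle\rangle=\langle 1,a_1\rangle\otimes\cdots\otimes\langle 1,a_m\rangle$ (equal to $\langle 1\rangle$ if $m=0$). A form $\psi$ is a *subform* of $\varphi$ if $\varphi\simeq\psi\perp\psi'$ for some form $\psi'$. A field $k$ satisfies *property $\mathscr A_i(2)$* if every system of $s$ (possibly degenerate) quadratic forms over $k$ in $n>s\cdot 2^i$ common variables has a non-trivial simultaneous zero in an odd degree extension of $k$. $u(k)$ is the maximal dimension of an anisotropic quadratic form over $k$ ($\infty$ if there is no maximum). For a non-empty set $V$ of non-trivial discrete valuations on $k$ and integers $a,b\ge 1$, a form $q$ over $k$ *satisfies $\mathrm{LGP}(a,b)$ with respect to $V$* if [$i_W(q_{k_v})\ge a$ for all $v\in V$] implies $i_W(q)\ge b$, where $k_v$ is the completion of $k$ at $v$; otherwise it *violates* it. **Theorem.**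 Let $\ell$ be a field of characteristic $\ne 2$ that satisfies property $\mathscr A_i(2)$ for some integer $i\ge 0$, with $u(\ell)=2^i$. Let $r\ge 2$, let $L_r=\ell(x_1,\dots,x_r)$ be the rational function field in $r$ variables, let $L_{r-1}=\ell(x_1,\dots,x_{r-1})\subset L_r$, and let $V_r$ be the set of non-trivial discrete valuations on $L_r$ that are trivial on $L_{r-1}$. Let $n$ be an integer with $0\le n<2^{i+r-2}$. Then there is a $(2^{i+r}-n)$-dimensional nondegenerate quadratic form over $L_r$ that violates $\mathrm{LGP}(2^{i+r-2}-n,1)$ with respect to $V_r$. More precisely, for a $2^i$-dimensional quadratic form $q$ over $\ell$ put $$\varphi_{r,q}=\langle x_r+1,\,-x_{r-1}-x_r,\,x_{r-1},\,x_{r-1}x_r\rangle\otimes q\otimes\langle\langle x_1,\dots,x_{r-2}\rangle\rangle$$ over $L_r$. Then: 1. there is an anisotropic $2^i$-dimensional form $q$ over $\ell$ such that $\varphi_{r,q}$ has a nondegenerate subform of dimension $2^{i+r}-n$ that violates $\mathrm{LGP}(2^{i+r-2}-n,1)$ with respect to $V_r$; 2. for every anisotropic $2^i$-dimensional form $q$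 over $\ell$, every subform of $\varphi_{r,q}$ of dimension $2^{i+r}-n$ violates $\mathrm{LGP}(2^{i+r-2}-n,1)$ with respect to $V_r$ (for $n=0$: $\varphi_{r,q}$ itself violates $\mathrm{LGP}(2^{i+r-2},1)$). -/

import Mathlib

open scoped TensorProduct WithZero

universe u v w

noncomputable section

namespace LGP

/-- The quadratic form `q` is regular, that is, nondegenerate. -/
def IsRegular {k : Type u} [Field k] {M : Type v} [AddCommGroup M] [Module k M]
    (q : QuadraticForm k M) : Prop :=
  QuadraticMap.Nondegenerate (Q := q)

/-- `φ` is a subform of `q` if `q ≃ φ ⊥ ψ` for some quadratic form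
`ψ` (which is automatically regular when `q` is). -/
def IsSubform {k : Type u} [Field k] {M : Type v} [AddCommGroup M] [Module k M]
    {N : Type w} [AddCommGroup N] [Module k N]
    (φ : QuadraticForm k M) (q : QuadraticForm k N) : Prop :=
  ∃ (n : ℕ) (ψ : QuadraticForm k (Fin n → k)), q.Equivalent (φ.prod ψ)

/-- The hyperbolic plane `x² - y²`. -/
def hyperbolicPlane (k : Type u) [Field k] : QuadraticForm k (Fin 2 → k) :=
  QuadraticMap.weightedSumSquares k ![(1 : k), -1]

/-- The orthogonal sum of `m` hyperbolic planes. -/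
def hyperbolicForm (k : Type u) [Field k] (m : ℕ) : QuadraticForm k (Fin m → Fin 2 → k) :=
  QuadraticMap.pi fun _ => hyperbolicPlane k

/-- The Witt index of a (regular, finite-dimensional) quadratic form over a field of
characteristic not two: the largest number of hyperbolic planes that split off orthogonally. -/
def wittIndex {k : Type u} [Field k] {M : Type v} [AddCommGroup M] [Module k M]
    (q : QuadraticForm k M) : ℕ :=
  sSup {m : ℕ | IsSubform (hyperbolicForm k m) q}

/-- The `u`-invariant: the maximal dimension of an anisotropic quadratic form, `⊤` if there is no
maximum. (Anisotropic forms are automatically regular in characteristic not two.) -/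
def uInvariant (k : Type u) [Field k] : ℕ∞ :=
  ⨆ n ∈ {n : ℕ | ∃ q : QuadraticForm k (Fin n → k), q.Anisotropic}, (n : ℕ∞)

/-- Property `𝒜ᵢ(2)`: every system of `s` (arbitrary, possibly degenerate) quadratic forms over `k`
in `n > s * 2 ^ i` common variables has a non-trivial simultaneous zero over some field extension
of `k` of odd degree. (`finrank` is zero for an infinite extension, so `Odd` forces finiteness.) -/
def PropertyA2 (k : Type u) [Field k] [Invertible (2 : k)] (i : ℕ) : Prop :=
  ∀ (s n : ℕ) (f : Fin s → QuadraticForm k (Fin n → k)), s * 2 ^ i < n →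
    ∃ (K : Type u) (_ : Field K) (_ : Algebra k K), Odd (Module.finrank k K) ∧
      ∃ z : K ⊗[k] (Fin n → k), z ≠ 0 ∧ ∀ j, (f j).baseChange K z = 0

/-- The completion `k_v` of `k` at `v`, as an extension of `k` through the canonical embedding. -/
instance completionAlgebra {k : Type u} [Field k] (v : Valuation k ℤᵐ⁰) :
    Algebra k v.Completion :=
  ((algebraMap (WithVal v) v.Completion).comp (WithVal.equiv v).symm.toRingHom).toAlgebra

/-- The quadratic form `q` satisfies `LGP(r, s)` with respect to a set `V` of discrete valuations
on `k`: if `i_W(q_v) ≥ r` over the completion `k_v` for every `v ∈ V`, then `i_W(q) ≥ s`. -/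
def SatisfiesLGP {k : Type u} [Field k] [Invertible (2 : k)] {M : Type v} [AddCommGroup M]
    [Module k M] (V : Set (Valuation k ℤᵐ⁰)) (q : QuadraticForm k M) (r s : ℕ) : Prop :=
  (∀ v ∈ V, r ≤ wittIndex (q.baseChange v.Completion)) → s ≤ wittIndex q

/-- The rational function field `L_r = ℓ(x_1, …, x_r)`. -/
abbrev RatField (ℓ : Type u) [Field ℓ] (r : ℕ) : Type u :=
  FractionRing (MvPolynomial (Fin r) ℓ)

instance (ℓ : Type u) [Field ℓ] [Invertible (2 : ℓ)] (r : ℕ) : Invertible (2 : RatField ℓ r) :=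
  (Invertible.map (algebraMap ℓ (RatField ℓ r)) 2).copy 2 (map_ofNat _ _).symm

/-- The variables of `L_r`; the variable `x_j` of the usual numbering has index `j - 1`. -/
def ratVar (ℓ : Type u) [Field ℓ] (r : ℕ) (j : Fin r) : RatField ℓ r :=
  algebraMap (MvPolynomial (Fin r) ℓ) (RatField ℓ r) (MvPolynomial.X j)

/-- The subfield `L_{r-1} = ℓ(x_1, …, x_{r-1})` of `L_r`. -/
def ratSubfield (ℓ : Type u) [Field ℓ] (r : ℕ) : IntermediateField ℓ (RatField ℓ r) :=
  IntermediateField.adjoin ℓ (ratVar ℓ r '' {j | (j : ℕ) < r - 1})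

/-- The set `V_r` of non-trivial discrete valuations on `L_r` that are trivial on `L_{r-1}`.
A discrete valuation is one with values in `ℤ ∪ {∞}`, written multiplicatively. -/
def valuationSet (ℓ : Type u) [Field ℓ] (r : ℕ) : Set (Valuation (RatField ℓ r) ℤᵐ⁰) :=
  {v | v.IsNontrivial ∧ ∀ a ∈ ratSubfield ℓ r, a ≠ 0 → v a = 1}

/-- The Pfister form `⟨⟨a_1, …, a_m⟩⟩ = ⟨1, a_1⟩ ⊗ ⋯ ⊗ ⟨1, a_m⟩`, in its expanded diagonal form
with one entry `∏_{j ∈ S} a_j` for each subset `S` of the index set. -/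
def pfisterForm {k : Type u} [Field k] {m : ℕ} (a : Fin m → k) :
    QuadraticForm k (Finset (Fin m) → k) :=
  QuadraticMap.weightedSumSquares k fun S : Finset (Fin m) => ∏ j ∈ S, a j

/-- The form
`⟨x_r + 1, -x_{r-1} - x_r, x_{r-1}, x_{r-1} x_r⟩ ⊗ q ⊗ ⟨⟨x_1, …, x_{r-2}⟩⟩` over `L_r`. -/
def phiForm (ℓ : Type u) [Field ℓ] [Invertible (2 : ℓ)] (r : ℕ) (hr : 2 ≤ r) {d : ℕ}
    (q : QuadraticForm ℓ (Fin d → ℓ)) :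
    QuadraticForm (RatField ℓ r) ((Fin 4 → RatField ℓ r) ⊗[RatField ℓ r]
      ((RatField ℓ r ⊗[ℓ] (Fin d → ℓ)) ⊗[RatField ℓ r]
        (Finset (Fin (r - 2)) → RatField ℓ r))) :=
  let x : Fin r → RatField ℓ r := ratVar ℓ r
  let y : RatField ℓ r := x ⟨r - 2, by omega⟩
  let z : RatField ℓ r := x ⟨r - 1, by omega⟩
  QuadraticForm.tmul
    (QuadraticMap.weightedSumSquares (RatField ℓ r) ![z + 1, -y - z, y, y * z])
    (QuadraticForm.tmul (q.baseChange (RatField ℓ r))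
      (pfisterForm fun j : Fin (r - 2) => x ⟨j, by omega⟩))

end LGP

end

/-!
For `q` anisotropic the form `φ = phiForm ℓ r hr q` and all its subforms are anisotropic over `L_r`,
while over each completion `φ` has a totally isotropic subspace of dimension `2 ^ (i + r - 2)`; a
subform of codimension `n` loses at most `n` of these dimensions
(`le_wittIndex_baseChange_of_isometry`).

*Globally*, `φ` is the orthogonal sum of the multiples of `q` by the polynomials `f * ∏_{j ∈ S} x_j`
with `f` one of `x_r + 1`, `-x_{r-1} - x_r`, `x_{r-1}`, `x_{r-1} x_r`. In the lexicographic order of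
monomials in which `x_r` is lower than `x_{r-1}`, the lowest terms of these polynomials have
exponents that are pairwise distinct modulo two. Since `q` is anisotropic, the lowest term of one of
its values has an exponent in `2ℤ^r`, and so the lowest terms of the summands cannot cancel
(`eq_zero_of_sum_weights_mul_sq`, `anisotropic_phiForm`).

*Locally*, put `y = x_{r-1}` and `z = x_r`. At a place of `V_r` the constants and `y`, `y - 1` are
units, and elements congruent to `1` are squares in the completion (`exists_sq_eq_one_add`, by
Newton's iteration). If `z` reduces to `0`, `-1`, `-y` or `∞`, then `⟨z + 1, -y - z, y, yz⟩` is
isotropic over the completion, and otherwise its entries are units (`units_or_isotropic`). In the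
first case an isotropic line tensored with the other factors of `φ` is the required subspace. In the
second one, property `𝒜ᵢ(2)` enters. Comparing coefficients of polynomials turns a diagonal form
over `L_r` in more than `2 ^ (i + r)` variables into a system of quadratic forms over `ℓ` with
sufficiently many variables; its zero over an extension of odd degree descends by Springer's theorem
(`anisotropic_of_odd_finrank`), whence `u(L_r) ≤ 2 ^ (i + r)` (`isotropicAbove_ratField`). If `a`
has unit entries and an anisotropic reduction and the value of `p` is odd in the value group, then
`a ⊥ p a` is anisotropic over `L_r`, so forms over the residue field in more than `2 ^ (i + r - 1)`
variables are isotropic (`isotropicAbove_resField`). Hence the reduction of `φ` has a totally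
isotropic subspace of dimension `2 ^ (i + r - 2)`, which is lifted to the completion by
orthogonalization and extraction of square roots (`exists_isotropic_subspace_completion`).
-/

noncomputable section

namespace LGP

/-! ### Witt index and totally isotropic subspaces -/

section WittIndex

open QuadraticMap Module

variable {k : Type u} [Field k] {M : Type v} [AddCommGroup M] [Module k M]
  {N : Type w} [AddCommGroup N] [Module k N]

theorem polar_eq_of_isometry {φ : QuadraticForm k M} {q : QuadraticForm k N} (f : φ →qᵢ q)
    (x y : M) : polar q (f x) (f y) = polar φ x y := by
  simp only [polar, ← map_add, f.map_app]

/-- An isometry out of a nondegenerate form is injective: its kernel lies in the radical. -/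
theorem isometry_injective [Invertible (2 : k)] {φ : QuadraticForm k M} {q : QuadraticForm k N}
    (hφ : φ.Nondegenerate) (f : φ →qᵢ q) : Function.Injective f := by
  rw [injective_iff_map_eq_zero]
  intro x hx
  have hx' : x ∈ φ.radical := by
    rw [mem_radical_iff']
    refine ⟨by rw [← f.map_app, hx, QuadraticMap.map_zero], fun y => ?_⟩
    rw [← f.map_app, map_add, hx, zero_add, f.map_app]
  rw [hφ.radical_eq_bot] at hx'
  simpa using hx'

/-- A nondegenerate form that embeds isometrically splits off orthogonally. -/
theorem isSubform_of_isometry [Invertible (2 : k)] [FiniteDimensional k N]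
    {φ : QuadraticForm k M} {q : QuadraticForm k N}
    (hφ : φ.Nondegenerate) (f : φ →qᵢ q) : IsSubform φ q := by
  have hinj := isometry_injective hφ f
  set B : LinearMap.BilinForm k N := polarBilin q with hB
  set W : Submodule k N := LinearMap.range f.toLinearMap with hW
  have hrefl : B.IsRefl := fun x y h => by
    rw [hB, polarBilin_apply_apply] at h ⊢
    rwa [polar_comm]
  have hnd : (B.restrict W).Nondegenerate := by
    have hr : (B.restrict W).IsRefl := fun x y h => hrefl _ _ h
    refine (LinearMap.IsRefl.nondegenerate_iff_separatingLeft (B := B.restrict W) hr).2 ?_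
    rintro ⟨_, x, rfl⟩ hx
    have hx0 : x = 0 := by
      have : x ∈ φ.polarBilin.ker := by
        rw [LinearMap.mem_ker]
        ext y
        have := hx ⟨_, y, rfl⟩
        simpa [hB, LinearMap.BilinForm.restrict_apply, polar_eq_of_isometry] using this
      rw [← radical_eq_ker_polarBilin, hφ.radical_eq_bot] at this
      simpa using this
    subst hx0
    ext
    simp
  have hc : IsCompl W (B.orthogonal W) :=
    LinearMap.BilinForm.isCompl_orthogonal_of_restrict_nondegenerate hrefl hnd
  let e₁ : M ≃ₗ[k] W := LinearEquiv.ofInjective f.toLinearMap hinj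
  let e₂ := (Module.finBasis k (B.orthogonal W)).equivFun.symm
  let e : (M × (Fin (finrank k (B.orthogonal W)) → k)) ≃ₗ[k] N :=
    (e₁.prodCongr e₂).trans (Submodule.prodEquivOfIsCompl W _ hc)
  refine ⟨_, q.comp ((B.orthogonal W).subtype ∘ₗ e₂.toLinearMap), ⟨?_⟩⟩
  refine (⟨e, ?_⟩ : (φ.prod _).IsometryEquiv q).symm
  rintro ⟨x, y⟩
  have hxy : B (f x) (e₂ y : N) = 0 := (e₂ y).2 (f x) ⟨x, rfl⟩
  have he : e (x, y) = f x + (e₂ y : N) := by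
    simp only [e, e₁, LinearEquiv.trans_apply, LinearEquiv.prodCongr_apply,
      Submodule.coe_prodEquivOfIsCompl']
    rfl
  change q (e (x, y)) = _
  have hxy' : q (f x + (e₂ y : N)) = q (f x) + q (e₂ y : N) := by
    rwa [← sub_eq_zero, ← sub_sub]
  rw [he, hxy']
  simp

theorem nondegenerate_weightedSumSquares [Invertible (2 : k)] {ι : Type*} [Fintype ι]
    {a : ι → k} (ha : ∀ i, a i ≠ 0) : (weightedSumSquares k a).Nondegenerate := by
  have : NeZero (2 : k) := ⟨Invertible.ne_zero 2⟩
  rw [nondegenerate_iff_radical_eq_bot, QuadraticForm.radical_weightedSumSquares, eq_bot_iff]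
  intro x hx
  rw [Pi.mem_spanSubset_iff] at hx
  ext i
  exact hx i (by simpa using ha i)

theorem Nondegenerate.of_equivalent [Invertible (2 : k)] {φ : QuadraticForm k M}
    {q : QuadraticForm k N} (h : φ.Equivalent q) (hφ : φ.Nondegenerate) : q.Nondegenerate := by
  obtain ⟨e⟩ := h
  rw [nondegenerate_iff_radical_eq_bot, ← e.map_radical, hφ.radical_eq_bot, Submodule.map_bot]

theorem Nondegenerate.of_anisotropic [Invertible (2 : k)] {φ : QuadraticForm k M}
    (h : φ.Anisotropic) : φ.Nondegenerate := by
  rw [nondegenerate_iff_radical_eq_bot, eq_bot_iff]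
  intro x hx
  rw [mem_radical_iff'] at hx
  simpa using h x hx.1

theorem hyperbolicForm_apply (m : ℕ) (x : Fin m → Fin 2 → k) :
    hyperbolicForm k m x = ∑ i, (x i 0 * x i 0 - x i 1 * x i 1) := by
  simp [hyperbolicForm, hyperbolicPlane, Fin.sum_univ_two, sub_eq_add_neg]

theorem polar_hyperbolicForm (m : ℕ) (x y : Fin m → Fin 2 → k) :
    polar (hyperbolicForm k m) x y = 2 * ∑ i, (x i 0 * y i 0 - x i 1 * y i 1) := by
  simp only [polar, hyperbolicForm_apply, Pi.add_apply, Finset.mul_sum, ← Finset.sum_sub_distrib]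
  exact Finset.sum_congr rfl fun i _ => by ring

theorem nondegenerate_hyperbolicForm [Invertible (2 : k)] (m : ℕ) :
    (hyperbolicForm k m).Nondegenerate := by
  classical
  rw [nondegenerate_iff_radical_eq_bot, eq_bot_iff]
  intro x hx
  rw [mem_radical_iff'] at hx
  have h2 : (2 : k) ≠ 0 := Invertible.ne_zero 2
  have key : ∀ y, polar (hyperbolicForm k m) x y = 0 := fun y => by
    rw [polar, hx.2, hx.1]; simp
  have h0 : ∀ i, x i 0 = 0 := fun i => by
    have := key (Pi.single i ![1, 0])
    rw [polar_hyperbolicForm, Finset.sum_eq_single i (fun j _ hj => by simp [Pi.single_eq_of_ne hj])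
      (by simp)] at this
    simpa [h2] using this
  have h1 : ∀ i, x i 1 = 0 := fun i => by
    have := key (Pi.single i ![0, 1])
    rw [polar_hyperbolicForm, Finset.sum_eq_single i (fun j _ hj => by simp [Pi.single_eq_of_ne hj])
      (by simp)] at this
    simpa [h2] using this
  simp only [Submodule.mem_bot]
  ext i j
  fin_cases j
  · exact h0 i
  · exact h1 i

/-- A totally isotropic family spanning an `m`-dimensional space in a nondegenerate quadratic
space can be completed to `m` orthogonal hyperbolic planes. -/
theorem exists_isometry_hyperbolicForm [Invertible (2 : k)] [FiniteDimensional k N]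
    {q : QuadraticForm k N} (hq : q.Nondegenerate) {m : ℕ} {e : Fin m → N}
    (he : LinearIndependent k e)
    (horth : ∀ i j, polar q (e i) (e j) = 0) :
    Nonempty (hyperbolicForm k m →qᵢ q) := by
  classical
  set B : LinearMap.BilinForm k N := polarBilin q with hB
  have hBnd : B.Nondegenerate := nondegenerate_polar_iff.2 hq
  have hBsymm : ∀ x y, B x y = B y x := fun x y => polar_comm q x y
  -- vectors dual to the family, through the isomorphism of the space with its dual
  have hdual : ∀ i, ∃ g : N, ∀ j, B g (e j) = if i = j then 1 else 0 := fun i => by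
    obtain ⟨F, hF⟩ := LinearMap.exists_extend (p := Submodule.span k (Set.range e))
      ((Finsupp.lapply i : (Fin m →₀ k) →ₗ[k] k) ∘ₗ (he.repr : _ →ₗ[k] _))
    refine ⟨(B.toDual hBnd).symm F, fun j => ?_⟩
    rw [LinearMap.BilinForm.apply_toDual_symm_apply]
    have hj : e j ∈ Submodule.span k (Set.range e) := Submodule.subset_span ⟨j, rfl⟩
    have := LinearMap.congr_fun hF ⟨e j, hj⟩
    simp only [LinearMap.comp_apply, Submodule.subtype_apply] at this
    rw [this]
    simp [he.repr_eq_single j ⟨e j, hj⟩ rfl, Finsupp.single_apply, eq_comm]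
  choose g hg using hdual
  -- the correction makes the dual family totally isotropic
  let f : Fin m → N := fun i => g i - (⅟(2 : k)) • ∑ j, B (g i) (g j) • e j
  have hfe : ∀ i j, B (f i) (e j) = if i = j then 1 else 0 := fun i j => by
    have : ∀ l, B (e l) (e j) = 0 := fun l => horth l j
    simp [f, hg, this]
  have hff : ∀ i j, B (f i) (f j) = 0 := fun i j => by
    have h1 : B (f i) (f j) = B (f i) (g j) - ⅟2 * B (g j) (g i) := by
      conv_lhs => rw [show f j = g j - (⅟(2 : k)) • ∑ l, B (g j) (g l) • e l from rfl]
      simp [hfe, map_sub, map_sum]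
    have h2 : B (f i) (g j) = B (g i) (g j) - ⅟2 * B (g i) (g j) := by
      simp [f, hBsymm (e _) (g j), hg]
    rw [h1, h2, hBsymm (g j) (g i)]
    have : (⅟2 : k) * 2 = 1 := invOf_mul_self 2
    linear_combination (-B (g i) (g j)) * this
  have hpol : ∀ x y, q (x + y) = q x + q y + B x y := fun x y => by
    rw [hB, polarBilin_apply_apply, polar]; ring
  have hself : ∀ x, q x = ⅟2 * B x x := fun x => by
    have := hpol x x
    rw [← two_smul k x, QuadraticMap.map_smul] at this
    have h2 : (⅟2 : k) * 2 = 1 := invOf_mul_self 2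
    simp only [smul_eq_mul] at this
    linear_combination ⅟2 * this - q x * h2
  let p : Fin m → Fin 2 → (Fin m → Fin 2 → k) →ₗ[k] k := fun i j =>
    LinearMap.proj j ∘ₗ LinearMap.proj i
  let T : (Fin m → Fin 2 → k) →ₗ[k] N :=
    ∑ i, (p i 0 + p i 1).smulRight (e i) + ∑ i, (p i 0 - p i 1).smulRight (f i)
  refine ⟨⟨T, fun x => ?_⟩⟩
  have hT : T x = ∑ i, (x i 0 + x i 1) • e i + ∑ i, (x i 0 - x i 1) • f i := by
    simp [T, p, LinearMap.sum_apply]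
  have hee : B (∑ i, (x i 0 + x i 1) • e i) (∑ i, (x i 0 + x i 1) • e i) = 0 := by
    have : ∀ l j, B (e l) (e j) = 0 := fun l j => horth l j
    simp [this, LinearMap.sum_apply]
  have hff' : B (∑ i, (x i 0 - x i 1) • f i) (∑ i, (x i 0 - x i 1) • f i) = 0 := by
    simp [hff, LinearMap.sum_apply]
  have hef : B (∑ i, (x i 0 + x i 1) • e i) (∑ i, (x i 0 - x i 1) • f i) =
      ∑ i, (x i 0 - x i 1) * (x i 0 + x i 1) := by
    rw [hBsymm]
    simp [hfe, LinearMap.sum_apply, mul_comm]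
  change q (T x) = _
  rw [hT, hpol, hself, hee, hself (∑ i, (x i 0 - x i 1) • f i), hff', hef, hyperbolicForm_apply]
  simp only [mul_zero, zero_add]
  exact Finset.sum_congr rfl fun i _ => by ring

theorem isotropic_polar_eq_zero {q : QuadraticForm k N} {W : Submodule k N}
    (hW : ∀ x ∈ W, q x = 0) {x y : N} (hx : x ∈ W) (hy : y ∈ W) : polar q x y = 0 := by
  simp [polar, hW _ hx, hW _ hy, hW _ (W.add_mem hx hy)]

theorem two_mul_le_finrank_of_isSubform [Invertible (2 : k)] [FiniteDimensional k N]
    {q : QuadraticForm k N} {m : ℕ} (h : IsSubform (hyperbolicForm k m) q) :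
    m * 2 ≤ finrank k N := by
  obtain ⟨n, ψ, ⟨e⟩⟩ := h
  rw [e.toLinearEquiv.finrank_eq]
  simp [finrank_pi_fintype]

theorem bddAbove_isSubform_hyperbolicForm [Invertible (2 : k)] [FiniteDimensional k N]
    (q : QuadraticForm k N) : BddAbove {m : ℕ | IsSubform (hyperbolicForm k m) q} :=
  ⟨finrank k N, fun m hm => by
    have := two_mul_le_finrank_of_isSubform (m := m) hm
    omega⟩

theorem exists_isometry_hyperbolicForm_of_isotropic [Invertible (2 : k)] [FiniteDimensional k N]
    {q : QuadraticForm k N} (hq : q.Nondegenerate) {W : Submodule k N}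
    (hW : ∀ x ∈ W, q x = 0) {m : ℕ} (hm : m ≤ finrank k W) :
    Nonempty (hyperbolicForm k m →qᵢ q) := by
  let b := Module.finBasis k W
  have hb : LinearIndependent k fun i => (b i : N) :=
    b.linearIndependent.map' W.subtype (Submodule.ker_subtype W)
  exact exists_isometry_hyperbolicForm hq (e := fun i => (b (Fin.castLE hm i) : N))
    (hb.comp _ (Fin.castLE_injective hm))
    fun i j => isotropic_polar_eq_zero hW (b _).2 (b _).2

/-- The dimension of a totally isotropic subspace of a nondegenerate form bounds the Witt index from
below. -/
theorem le_wittIndex_of_isotropic [Invertible (2 : k)] [FiniteDimensional k N]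
    {q : QuadraticForm k N} (hq : q.Nondegenerate) {W : Submodule k N}
    (hW : ∀ x ∈ W, q x = 0) {m : ℕ} (hm : m ≤ finrank k W) : m ≤ wittIndex q := by
  obtain ⟨f⟩ := exists_isometry_hyperbolicForm_of_isotropic hq hW hm
  exact le_csSup (bddAbove_isSubform_hyperbolicForm q)
    (isSubform_of_isometry (nondegenerate_hyperbolicForm m) f)

theorem wittIndex_eq_zero_of_anisotropic {q : QuadraticForm k N} (hq : q.Anisotropic) :
    wittIndex q = 0 := by
  have : {m : ℕ | IsSubform (hyperbolicForm k m) q} ⊆ {0} := by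
    rintro m ⟨n, ψ, ⟨e⟩⟩
    by_contra hm
    have hm' : 0 < m := Nat.pos_of_ne_zero hm
    -- the vector `(1, 1)` of the first hyperbolic plane is isotropic
    let x : Fin m → Fin 2 → k := Pi.single ⟨0, hm'⟩ 1
    have hx : hyperbolicForm k m x = 0 := by
      rw [hyperbolicForm_apply, Finset.sum_eq_zero]
      intro i _
      by_cases hi : i = ⟨0, hm'⟩
      · subst hi; simp [x]
      · simp [x, Pi.single_eq_of_ne hi]
    have h0 := hq (e.symm (x, 0)) (by simp [hx])
    have h1 : ((x, 0) : _ × (Fin n → k)) = 0 := by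
      rw [← e.apply_symm_apply (x, 0), h0, map_zero]
    have h2 : x ⟨0, hm'⟩ 0 = 0 := by
      rw [show x = 0 from congrArg Prod.fst h1]; rfl
    simp [x] at h2
  rcases Set.subset_singleton_iff_eq.1 this with h | h <;> simp [wittIndex, h]

/-- A nondegenerate form over a field, all of whose forms in more than `n` variables are
isotropic, has a totally isotropic subspace whose codimension is at most its dimension plus `n`:
a complement of a maximal totally isotropic subspace inside its orthogonal is anisotropic. -/
theorem exists_isotropic_subspace [Invertible (2 : k)] [FiniteDimensional k N] {n : ℕ}
    (hn : ∀ d, n < d → ∀ f : QuadraticForm k (Fin d → k), ¬ f.Anisotropic)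
    {q : QuadraticForm k N} (hq : q.Nondegenerate) :
    ∃ W : Submodule k N, (∀ x ∈ W, q x = 0) ∧ finrank k N ≤ 2 * finrank k W + n := by
  classical
  set B : LinearMap.BilinForm k N := polarBilin q with hB
  have hBnd : B.Nondegenerate := nondegenerate_polar_iff.2 hq
  have hrefl : B.IsRefl := fun x y h => by
    rw [hB, polarBilin_apply_apply] at h ⊢
    rwa [polar_comm]
  obtain ⟨W, hW, hmax⟩ : ∃ W : Submodule k N, (∀ x ∈ W, q x = 0) ∧
      ∀ W' : Submodule k N, (∀ x ∈ W', q x = 0) → finrank k W' ≤ finrank k W := by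
    have hfin : {d : ℕ | ∃ W : Submodule k N, (∀ x ∈ W, q x = 0) ∧ finrank k W = d}.Finite :=
      (Set.finite_Iic (finrank k N)).subset (by
        rintro _ ⟨W, _, rfl⟩
        exact W.finrank_le)
    obtain ⟨d, ⟨W, hW, rfl⟩, hd⟩ := Set.exists_max_image _ id hfin
      ⟨0, ⊥, by simp, by simp⟩
    exact ⟨W, hW, fun W' hW' => hd _ ⟨W', hW', rfl⟩⟩
  refine ⟨W, hW, ?_⟩
  have hWO : W ≤ B.orthogonal W := fun x hx y hy => isotropic_polar_eq_zero hW hy hx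
  obtain ⟨U, hU1, hU2⟩ := IsModularLattice.exists_disjoint_and_sup_eq hWO
  have hUO : U ≤ B.orthogonal W := hU2 ▸ le_sup_right
  have haniso : (q.comp U.subtype).Anisotropic := by
    intro x hx
    by_contra hx0
    have hx0' : (x : N) ∉ W := fun h => hx0 (by
      have := Submodule.disjoint_def.1 hU1 x h x.2
      exact Subtype.ext this)
    have h1 := hmax (W ⊔ Submodule.span k {(x : N)}) (by
      intro y hy
      obtain ⟨w, hw, z, hz, rfl⟩ := Submodule.mem_sup.1 hy
      obtain ⟨c, rfl⟩ := Submodule.mem_span_singleton.1 hz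
      have hwx : polar q w (x : N) = 0 := hUO x.2 w hw
      have hx' : q (x : N) = 0 := hx
      rw [QuadraticMap.map_add q, hW w hw, QuadraticMap.map_smul, polar_smul_right, hwx, hx']
      simp)
    have h2 : finrank k W < finrank k (W ⊔ Submodule.span k {(x : N)} : Submodule k N) := by
      refine Submodule.finrank_lt_finrank_of_lt (lt_of_le_of_ne le_sup_left fun h => hx0' ?_)
      rw [h]
      exact Submodule.mem_sup_right (Submodule.mem_span_singleton_self _)
    omega
  have hUn : finrank k U ≤ n := by
    by_contra! h
    refine hn _ h ((q.comp U.subtype).comp (Module.finBasis k U).equivFun.symm.toLinearMap) ?_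
    intro x hx
    exact (map_eq_zero_iff _ (Module.finBasis k U).equivFun.symm.injective).1 (haniso _ hx)
  have h1 : finrank k (B.orthogonal W) = finrank k N - finrank k W :=
    LinearMap.BilinForm.finrank_orthogonal hBnd W
  have h2 := Submodule.finrank_sup_add_finrank_inf_eq W U
  rw [hU2, hU1.eq_bot, finrank_bot] at h2
  omega

end WittIndex

/-! ### Square roots in the completion -/

section SquareRoot

open Filter Topology

variable {k : Type u} [Field k] (v : Valuation k ℤᵐ⁰)

/-- Newton's iteration for the square root of `a`, started at `1`. -/
def newtonSqrt (a : k) : ℕ → k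
  | 0 => 1
  | n + 1 => newtonSqrt a n - (newtonSqrt a n ^ 2 - a) / (2 * newtonSqrt a n)

/-- Each step of the iteration gains at least one factor `v ε` of precision. -/
theorem newtonSqrt_spec (h2 : v 2 = 1) {ε : k} (hε : v ε < 1) (n : ℕ) :
    v (newtonSqrt (1 + ε) n) = 1 ∧
      v (newtonSqrt (1 + ε) n ^ 2 - (1 + ε)) ≤ v ε ^ (n + 1) := by
  induction n with
  | zero => simp [newtonSqrt, Valuation.map_neg]
  | succ n ih =>
    obtain ⟨h1, hle⟩ := ih
    set s := newtonSqrt (1 + ε) n with hs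
    have hs0 : s ≠ 0 := by rintro h; simp [h] at h1
    have h20 : (2 : k) ≠ 0 := by rintro h; simp [h] at h2
    have hlt : v (s ^ 2 - (1 + ε)) < 1 := hle.trans_lt (pow_lt_one₀ zero_le hε (by simp))
    have hd : v ((s ^ 2 - (1 + ε)) / (2 * s)) = v (s ^ 2 - (1 + ε)) := by simp [h1, h2]
    have hstep : newtonSqrt (1 + ε) (n + 1) = s - (s ^ 2 - (1 + ε)) / (2 * s) := rfl
    refine ⟨?_, ?_⟩
    · rw [hstep, Valuation.map_sub_eq_of_lt_left, h1]
      rw [hd, h1]; exact hlt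
    · have : newtonSqrt (1 + ε) (n + 1) ^ 2 - (1 + ε) = ((s ^ 2 - (1 + ε)) / (2 * s)) ^ 2 := by
        rw [hstep]; field_simp; ring
      rw [this, map_pow, hd, pow_two (v _), pow_succ' (v ε)]
      exact mul_le_mul' (hle.trans (pow_le_of_le_one zero_le hε.le (by simp))) hle

theorem nonarchimedeanAddGroup_withVal : NonarchimedeanAddGroup (WithVal v) where
  is_nonarchimedean U hU := by
    obtain ⟨γ, hγ⟩ := Valued.mem_nhds_zero.1 hU
    have h := (Valued.hasBasis_nhds_zero (WithVal v) ℤᵐ⁰).mem_of_mem (i := γ) trivial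
    exact ⟨⟨(Valued.v (R := WithVal v)).restrict.ltAddSubgroup γ,
      AddSubgroup.isOpen_of_mem_nhds _ (g := 0) h⟩, hγ⟩

theorem tendsto_toVal_zero {ε : k} (hε : v ε < 1) {x : ℕ → k} (hx : ∀ n, v (x n) ≤ v ε ^ n) :
    Tendsto (fun n => WithVal.toVal v (x n)) atTop (𝓝 0) := by
  rw [(Valued.hasBasis_nhds_zero (WithVal v) ℤᵐ⁰).tendsto_right_iff]
  intro γ _
  obtain ⟨r, s, hr, hs, hγ⟩ := Valuation.exists_div_eq_of_unit Valued.v γ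
  obtain ⟨n, hn⟩ := exists_pow_lt₀ hε
    (Units.mk0 (v r.ofVal / v s.ofVal) (div_ne_zero hr.ne' hs.ne'))
  refine eventually_atTop.2 ⟨n, fun m hm => ?_⟩
  have hs' : 0 < Valued.v.restrict s := (Valuation.restrict_pos_iff _ _).2 hs
  rw [Set.mem_ofPred_eq, ← hγ, lt_div_iff₀ hs', ← map_mul, Valuation.restrict_lt_iff, map_mul,
    ← lt_div_iff₀ hs]
  exact ((hx m).trans (pow_le_pow_right_of_le_one' hε.le hm)).trans_lt hn

/-- Squares in the completion: an element congruent to `1` modulo the maximal ideal is a square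
when the residue characteristic is not two. -/
theorem exists_sq_eq_one_add (h2 : v 2 = 1) {ε : k} (hε : v ε < 1) :
    ∃ s : v.Completion, s ^ 2 = algebraMap k v.Completion (1 + ε) := by
  set u : ℕ → WithVal v := fun n => WithVal.toVal v (newtonSqrt (1 + ε) n) with hu
  have hspec := newtonSqrt_spec v h2 hε
  have := nonarchimedeanAddGroup_withVal v
  have hcau : CauchySeq u := by
    refine NonarchimedeanAddGroup.cauchySeq_of_tendsto_sub_nhds_zero ?_
    have := tendsto_toVal_zero v hε
      (x := fun n => newtonSqrt (1 + ε) (n + 1) - newtonSqrt (1 + ε) n) (fun n => by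
        have : newtonSqrt (1 + ε) (n + 1) - newtonSqrt (1 + ε) n =
          -((newtonSqrt (1 + ε) n ^ 2 - (1 + ε)) / (2 * newtonSqrt (1 + ε) n)) := by
          rw [newtonSqrt]; ring
        rw [this, Valuation.map_neg, map_div₀, map_mul, h2, (hspec n).1]
        simp only [mul_one, div_one]
        exact (hspec n).2.trans (pow_le_pow_right_of_le_one' hε.le (Nat.le_succ n)))
    exact this
  obtain ⟨s, hs⟩ := cauchySeq_tendsto_of_complete
    (u := fun n => ((u n : WithVal v) : v.Completion))
    (hcau.map (UniformSpace.Completion.uniformContinuous_coe (WithVal v)))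
  refine ⟨s, ?_⟩
  have h1 : Tendsto (fun n => ((u n ^ 2 : WithVal v) : v.Completion)) atTop (𝓝 (s ^ 2)) := by
    refine (hs.pow 2).congr fun n => ?_
    exact (map_pow UniformSpace.Completion.coeRingHom (u n) 2).symm
  have h0 := tendsto_toVal_zero v hε (x := fun n => newtonSqrt (1 + ε) n ^ 2 - (1 + ε))
    (fun n => (hspec n).2.trans (pow_le_pow_right_of_le_one' hε.le (Nat.le_succ n)))
  have h3 : Tendsto (fun n => ((u n ^ 2 : WithVal v) : v.Completion)) atTop
      (𝓝 ((WithVal.toVal v (1 + ε) : WithVal v) : v.Completion)) := by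
    have := (h0.add_const (WithVal.toVal v (1 + ε)))
    rw [zero_add] at this
    refine (UniformSpace.Completion.continuous_coe _).continuousAt.tendsto.comp
      (this.congr fun n => ?_)
    simp [hu]
  exact tendsto_nhds_unique h1 h3

end SquareRoot

/-! ### Diagonal forms -/

section Diagonal

open QuadraticMap Module

variable {k : Type u} [Field k]

/-- Every quadratic form over `k` in more than `N` variables is isotropic; stated for diagonal
forms, which suffices in characteristic not two. -/
def IsotropicAbove (k : Type u) [Field k] (N : ℕ) : Prop :=
  ∀ d, N < d → ∀ a : Fin d → k, ∃ x : Fin d → k, x ≠ 0 ∧ ∑ i, a i * x i ^ 2 = 0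

theorem IsotropicAbove.exists_ne_zero {N : ℕ} (h : IsotropicAbove k N) {ι : Type*} [Fintype ι]
    (hι : N < Fintype.card ι) (a : ι → k) : ∃ x : ι → k, x ≠ 0 ∧ ∑ i, a i * x i ^ 2 = 0 := by
  let e := Fintype.equivFin ι
  obtain ⟨x, hx0, hx⟩ := h _ hι (a ∘ e.symm)
  refine ⟨x ∘ e, fun h0 => hx0 ?_, ?_⟩
  · ext i
    simpa using congrFun h0 (e.symm i)
  · rw [← e.symm.sum_comp]
    simpa using hx

theorem anisotropic_of_equivalent {M : Type*} [AddCommGroup M] [Module k M] {N : Type*}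
    [AddCommGroup N] [Module k N] {q : QuadraticForm k M} {q' : QuadraticForm k N}
    (h : q.Equivalent q') (hq : q.Anisotropic) : q'.Anisotropic := by
  obtain ⟨e⟩ := h
  intro x hx
  have := hq (e.symm x) (by simp [hx])
  rw [← e.apply_symm_apply x, this, map_zero]

theorem exists_equivalent_weightedSumSquares [Invertible (2 : k)] {V : Type*} [AddCommGroup V]
    [Module k V] [FiniteDimensional k V] {q : QuadraticForm k V} (hq : q.Nondegenerate) :
    ∃ a : Fin (finrank k V) → k, (∀ i, a i ≠ 0) ∧
      q.Equivalent (weightedSumSquares k a) := by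
  obtain ⟨w, hw⟩ := QuadraticForm.equivalent_weightedSumSquares_units_of_nondegenerate' q
    ((nondegenerate_associated_iff.2 hq).1)
  refine ⟨fun i => w i, fun i => (w i).ne_zero, hw.trans ⟨⟨LinearEquiv.refl k _, fun x => ?_⟩⟩⟩
  simp [Units.smul_def]

theorem IsotropicAbove.not_anisotropic [Invertible (2 : k)] {N : ℕ} (h : IsotropicAbove k N)
    {d : ℕ} (hd : N < d) (f : QuadraticForm k (Fin d → k)) : ¬ f.Anisotropic := by
  intro hf
  obtain ⟨a, -, ha⟩ := exists_equivalent_weightedSumSquares (Nondegenerate.of_anisotropic hf)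
  obtain ⟨x, hx0, hx⟩ := h.exists_ne_zero (ι := Fin (finrank k (Fin d → k))) (by simpa) a
  exact hx0 (anisotropic_of_equivalent ha hf x (by simpa [pow_two] using hx))

variable {ι : Type*} [Fintype ι]

/-- The symmetric bilinear form `∑ aᵢ xᵢ yᵢ`. -/
def diagBilin (a : ι → k) : LinearMap.BilinForm k (ι → k) :=
  LinearMap.mk₂ k (fun x y => ∑ i, a i * x i * y i)
    (fun x x' y => by simp [mul_add, add_mul, Finset.sum_add_distrib])
    (fun c x y => by simp only [Pi.smul_apply, smul_eq_mul, Finset.mul_sum]; congr! 1; ring)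
    (fun x y y' => by simp [mul_add, Finset.sum_add_distrib])
    (fun c x y => by simp only [Pi.smul_apply, smul_eq_mul, Finset.mul_sum]; congr! 1; ring)

theorem diagBilin_apply (a x y : ι → k) : diagBilin a x y = ∑ i, a i * x i * y i := rfl

theorem diagBilin_comm (a x y : ι → k) : diagBilin a x y = diagBilin a y x := by
  simp only [diagBilin_apply]; congr! 1; ring

theorem diagBilin_self (a x : ι → k) : diagBilin a x x = weightedSumSquares k a x := by
  simp [diagBilin_apply, mul_assoc]

theorem weightedSumSquares_basisFun [DecidableEq ι] (a : ι → k) (i : ι) :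
    weightedSumSquares k a (Pi.basisFun k ι i) = a i := by
  rw [weightedSumSquares_apply, Finset.sum_eq_single i]
  · simp
  · intro j _ hj
    simp [Pi.single_eq_of_ne hj]
  · simp

theorem polar_weightedSumSquares (a x y : ι → k) :
    polar (weightedSumSquares k a) x y = 2 * diagBilin a x y := by
  simp only [polar, ← diagBilin_self, map_add, LinearMap.add_apply, diagBilin_comm a y x]
  ring

theorem diagBilin_map {K : Type*} [Field K] (f : k →+* K) (a x y : ι → k) :
    diagBilin (fun i => f (a i)) (fun i => f (x i)) (fun i => f (y i)) = f (diagBilin a x y) := by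
  simp [diagBilin_apply]

end Diagonal

/-! ### Reduction modulo a discrete valuation -/

section Residue

open QuadraticMap Module

variable {k : Type u} [Field k] (v : Valuation k ℤᵐ⁰)

/-- The residue field of a valuation. -/
abbrev resField : Type u := IsLocalRing.ResidueField v.valuationSubring

theorem residue_eq_zero_iff' (a : v.valuationSubring) :
    IsLocalRing.residue v.valuationSubring a = 0 ↔ v a < 1 := by
  rw [IsLocalRing.residue_eq_zero_iff, IsLocalRing.mem_maximalIdeal, mem_nonunits_iff]
  have ha : v a ≤ 1 := a.2
  constructor
  · intro h
    refine lt_of_le_of_ne ha fun h1 => h ?_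
    have h0 : (a : k) ≠ 0 := by rintro h0; simp [h0] at h1
    refine IsUnit.of_mul_eq_one ⟨(a : k)⁻¹, ?_⟩ (Subtype.ext (mul_inv_cancel₀ h0))
    rw [Valuation.mem_valuationSubring_iff, map_inv₀, h1, inv_one]
  · rintro h ⟨u, rfl⟩
    have hb : v ((u⁻¹ : (v.valuationSubring)ˣ) : v.valuationSubring) ≤ 1 :=
      ((u⁻¹ : (v.valuationSubring)ˣ) : v.valuationSubring).2
    have hu : v ((u : v.valuationSubring) : k) *
        v ((u⁻¹ : (v.valuationSubring)ˣ) : v.valuationSubring) = 1 := by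
      rw [← map_mul]
      have := congrArg (Subtype.val : v.valuationSubring → k) u.mul_inv
      rw [show ((u : v.valuationSubring) : k) * ((u⁻¹ : (v.valuationSubring)ˣ) :
        v.valuationSubring) = 1 from this, map_one]
    exact absurd hu (ne_of_lt ((mul_le_of_le_one_right' hb).trans_lt h))

theorem residue_ne_zero_iff' (a : v.valuationSubring) :
    IsLocalRing.residue v.valuationSubring a ≠ 0 ↔ v a = 1 := by
  rw [ne_eq, residue_eq_zero_iff', not_lt]
  exact ⟨fun h => le_antisymm a.2 h, fun h => h.ge⟩

/-- If the reduction of a diagonal form with unit entries is anisotropic, the form takes only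
values of even order. -/
theorem exists_map_sum_eq_sq {ι : Type*} [Fintype ι] (a : ι → v.valuationSubring)
    (ha : ∀ x : ι → resField v,
      ∑ i, IsLocalRing.residue v.valuationSubring (a i) * x i ^ 2 = 0 → x = 0)
    {x : ι → k} (hx : x ≠ 0) :
    ∃ i, x i ≠ 0 ∧ v (∑ j, (a j : k) * x j ^ 2) = v (x i) ^ 2 := by
  obtain ⟨i₀, hi₀⟩ := Function.ne_iff.1 hx
  have : Nonempty ι := ⟨i₀⟩
  obtain ⟨i, hi⟩ := Finite.exists_max fun i => v (x i)
  have hxi : x i ≠ 0 := fun h => by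
    have := hi i₀
    rw [h, map_zero, le_zero_iff, map_eq_zero] at this
    exact hi₀ this
  have hvxi : v (x i) ≠ 0 := (map_ne_zero v).2 hxi
  refine ⟨i, hxi, ?_⟩
  -- dividing by the coordinate of largest value makes `x` primitive
  let y : ι → v.valuationSubring := fun j => ⟨x j / x i, by
    rw [Valuation.mem_valuationSubring_iff, map_div₀]
    exact div_le_one_of_le₀ (hi j) zero_le⟩
  have hy : (∑ j, (a j : k) * x j ^ 2) =
      ((∑ j, a j * y j ^ 2 : v.valuationSubring) : k) * x i ^ 2 := by
    push_cast
    rw [Finset.sum_mul]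
    refine Finset.sum_congr rfl fun j _ => ?_
    simp only [y]
    field_simp
  rw [hy, map_mul, map_pow]
  suffices h : v ((∑ j, a j * y j ^ 2 : v.valuationSubring) : k) = 1 by rw [h, one_mul]
  rw [← residue_ne_zero_iff']
  intro h
  have h0 := ha (fun j => IsLocalRing.residue v.valuationSubring (y j)) (by simpa using h)
  have h1 := congrFun h0 i
  have : y i = 1 := Subtype.ext (div_self hxi)
  simp [this] at h1

/-- A nontrivial valuation with values in `ℤ` has an element of odd order relative to its value
group. -/
theorem exists_map_ne_sq (hv : v.IsNontrivial) : ∃ p : k, p ≠ 0 ∧ ∀ x, v x ^ 2 ≠ v p := by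
  obtain ⟨x₀, hx0, hx1⟩ := hv.exists_val_nontrivial
  -- an element of least positive absolute value of the logarithm
  have hex : ∃ n : ℕ, 0 < n ∧ ∃ x, v x ≠ 0 ∧ (WithZero.log (v x)).natAbs = n := by
    refine ⟨_, ?_, x₀, hx0, rfl⟩
    rw [Int.natAbs_pos]
    intro h
    apply hx1
    rw [← WithZero.exp_log hx0, h, WithZero.exp_zero]
  classical
  obtain ⟨hpos, p, hp0, hp⟩ := Nat.find_spec hex
  refine ⟨p, (map_ne_zero v).1 hp0, fun x hx => ?_⟩
  have hvx : v x ≠ 0 := by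
    rintro h
    rw [h] at hx
    exact hp0 (by simp [← hx])
  have hlog : (WithZero.log (v p)) = 2 * WithZero.log (v x) := by
    rw [← hx, WithZero.log_pow]
    simp
  refine Nat.find_min hex (m := (WithZero.log (v x)).natAbs) (by omega) ⟨by omega, x, hvx, rfl⟩

/-- If all forms over `k` in more than `2 * N` variables are isotropic, then all forms over the
residue field in more than `N` variables are: for a lift `a` of an anisotropic form and `p` of odd
order, `a ⊥ p a` would be anisotropic. -/
theorem isotropicAbove_resField (hv : v.IsNontrivial) {N : ℕ} (h : IsotropicAbove k (2 * N)) :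
    IsotropicAbove (resField v) N := by
  intro d hd a
  by_contra! hcon
  have haniso : ∀ x : Fin d → resField v, ∑ i, a i * x i ^ 2 = 0 → x = 0 := fun x hx => by
    by_contra hx0
    exact hcon x hx0 hx
  choose b hb using fun i => IsLocalRing.residue_surjective (a i)
  have hb' : ∀ x : Fin d → resField v,
      ∑ i, IsLocalRing.residue v.valuationSubring (b i) * x i ^ 2 = 0 → x = 0 := fun x hx =>
    haniso x (by simpa [hb] using hx)
  obtain ⟨p, hp0, hp⟩ := exists_map_ne_sq v hv
  obtain ⟨x, hx0, hx⟩ := h.exists_ne_zero (ι := Fin d ⊕ Fin d) (by simp; omega)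
    (Sum.elim (fun i => (b i : k)) fun i => p * b i)
  rw [Fintype.sum_sum_type] at hx
  simp only [Sum.elim_inl, Sum.elim_inr, mul_assoc] at hx
  rw [← Finset.mul_sum] at hx
  set y : Fin d → k := fun i => x (Sum.inl i) with hy
  set z : Fin d → k := fun i => x (Sum.inr i) with hz
  have hval : v (∑ i, (b i : k) * y i ^ 2) = v p * v (∑ i, (b i : k) * z i ^ 2) := by
    rw [← map_mul, eq_neg_of_add_eq_zero_left hx, Valuation.map_neg]
  by_cases hz0 : z = 0
  · by_cases hy0 : y = 0
    · exact hx0 (by ext (i | i); exacts [congrFun hy0 i, congrFun hz0 i])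
    · obtain ⟨i, hi, hvi⟩ := exists_map_sum_eq_sq v b hb' hy0
      rw [hvi] at hval
      simp [hz0, hi] at hval
  · obtain ⟨j, hj, hvj⟩ := exists_map_sum_eq_sq v b hb' hz0
    have hj' : v (z j) ≠ 0 := (map_ne_zero v).2 hj
    by_cases hy0 : y = 0
    · rw [hvj] at hval
      simp [hy0, hj, hp0] at hval
    · obtain ⟨i, hi, hvi⟩ := exists_map_sum_eq_sq v b hb' hy0
      rw [hvi, hvj] at hval
      refine hp (y i / z j) ?_
      rw [map_div₀, div_pow, hval]
      field_simp

/-- Gram-Schmidt orthogonalization of a family that is orthogonal modulo the maximal ideal. -/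
theorem exists_orthogonal_of_orthogonal_mod {V : Type*} [AddCommGroup V] [Module k V]
    (B : LinearMap.BilinForm k V) (hB : ∀ x y, B x y = B y x) {n : ℕ} (w : Fin n → V)
    (hself : ∀ a, v (B (w a) (w a)) = 1) (horth : ∀ a b, a ≠ b → v (B (w a) (w b)) < 1) :
    ∃ w' : Fin n → V, (∀ a b, a ≠ b → B (w' a) (w' b) = 0) ∧
      (∀ a, v (B (w' a) (w' a) - B (w a) (w a)) < 1) ∧
      ∀ a, w' a ∈ Submodule.span k (Set.range w) := by
  induction n with
  | zero => exact ⟨w, fun a => a.elim0, fun a => a.elim0, fun a => a.elim0⟩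
  | succ n ih =>
    set u := w 0 with hu
    have hu1 : v (B u u) = 1 := hself 0
    have hu0 : B u u ≠ 0 := by intro h; simp [h] at hu1
    let c : Fin n → k := fun a => B (w a.succ) u / B u u
    have hc : ∀ a, v (c a) < 1 := fun a => by
      rw [map_div₀, hu1, div_one]
      exact horth _ _ (Fin.succ_ne_zero a)
    let y : Fin n → V := fun a => w a.succ - c a • u
    have hyu : ∀ a, B (y a) u = 0 := fun a => by
      simp [y, c, hu0]
    have hyy : ∀ a b, B (y a) (y b) = B (w a.succ) (w b.succ) - c b * B (w a.succ) u :=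
        fun a b => by
      have h1 : B (y a) (y b) = B (y a) (w b.succ) := by
        conv_lhs => rw [show y b = w b.succ - c b • u from rfl]
        rw [map_sub, map_smul, hyu, smul_zero, sub_zero]
      rw [h1]
      have : c a * B u (w b.succ) = c b * B (w a.succ) u := by
        simp only [c, hB u]
        ring
      simp [y, this]
    have hcw : ∀ a b, v (c b * B (w (Fin.succ a)) u) < 1 := fun a b => by
      rw [map_mul]
      exact mul_lt_one_of_lt_of_le (hc b) (horth _ _ (Fin.succ_ne_zero a)).le
    obtain ⟨y', hy1, hy2, hy3⟩ := ih y
      (fun a => by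
        rw [hyy, Valuation.map_sub_eq_of_lt_left, hself]
        rw [hself]; exact hcw a a)
      (fun a b hab => by
        rw [hyy]
        exact Valuation.map_sub_lt _ (horth _ _ (fun h => hab (Fin.succ_injective _ h))) (hcw a b))
    have hy'u : ∀ a, B (y' a) u = 0 := fun a => by
      have : Submodule.span k (Set.range y) ≤ LinearMap.ker (B.flip u) := by
        rw [Submodule.span_le]
        rintro _ ⟨b, rfl⟩
        exact hyu b
      exact this (hy3 a)
    refine ⟨Fin.cons u y', ?_, ?_, ?_⟩
    · intro a b
      refine Fin.cases ?_ (fun a => ?_) a <;> refine Fin.cases ?_ (fun b => ?_) b <;> intro hab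
      · exact absurd rfl hab
      · simpa [hB u] using hy'u b
      · simpa using hy'u a
      · simpa using hy1 a b (fun h => hab (by rw [h]))
    · intro a
      refine Fin.cases ?_ (fun a => ?_) a
      · simp [hu]
      · have : B (y' a) (y' a) - B (w a.succ) (w a.succ) =
          (B (y' a) (y' a) - B (y a) (y a)) - c a * B (w a.succ) u := by rw [hyy]; ring
        simp only [Fin.cons_succ]
        rw [this]
        exact Valuation.map_sub_lt _ (hy2 a) (hcw a a)
    · intro a
      refine Fin.cases ?_ (fun a => ?_) a
      · exact Submodule.subset_span ⟨0, rfl⟩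
      · refine (Submodule.span_le.2 ?_ : Submodule.span k (Set.range y) ≤ _) (hy3 a)
        rintro _ ⟨b, rfl⟩
        exact Submodule.sub_mem _ (Submodule.subset_span ⟨_, rfl⟩)
          (Submodule.smul_mem _ _ (Submodule.subset_span ⟨0, rfl⟩))

/-- Two orthogonal vectors with values close to `1` and `-1` span a hyperbolic plane over the
completion. -/
theorem exists_sq_mul_add_eq_zero (h2 : v 2 = 1) {c d : k} (hc : v (c - 1) < 1)
    (hd : v (d + 1) < 1) :
    ∃ s : v.Completion, s ^ 2 * algebraMap k v.Completion c + algebraMap k v.Completion d = 0 := by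
  have hc1 : v c = 1 := by
    have := Valuation.map_add_eq_of_lt_right v (x := c - 1) (y := 1) (by simpa using hc)
    simpa using this
  have hc0 : c ≠ 0 := by rintro rfl; simp at hc1
  obtain ⟨s, hs⟩ := exists_sq_eq_one_add v h2 (ε := -(d + 1 + (c - 1)) / c) (by
    rw [map_div₀, hc1, div_one, Valuation.map_neg]
    exact Valuation.map_add_lt _ hd hc)
  refine ⟨s, ?_⟩
  rw [hs, ← map_mul, ← map_add, show (1 + -(d + 1 + (c - 1)) / c) * c + d = 0 by field_simp; ring,
    map_zero]

/-- A diagonal form with unit entries acquires over the completion totally isotropic subspaces of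
the dimension that is forced on its reduction. -/
theorem exists_isotropic_subspace_completion (h2 : v 2 = 1) {N M : ℕ}
    (hN : IsotropicAbove (resField v) N) {ι : Type*} [Fintype ι]
    (hι : 2 * M + N ≤ Fintype.card ι) (a : ι → k) (ha : ∀ i, v (a i) = 1) :
    ∃ W : Submodule v.Completion (ι → v.Completion),
      (∀ x ∈ W, weightedSumSquares v.Completion (fun i => algebraMap k v.Completion (a i)) x = 0) ∧
      finrank v.Completion W = M := by
  classical
  set res := IsLocalRing.residue v.valuationSubring with hres
  have h2res : (2 : resField v) ≠ 0 := by
    have := (residue_ne_zero_iff' v ⟨2, h2.le⟩).2 h2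
    rwa [show (⟨2, h2.le⟩ : v.valuationSubring) = 2 from rfl, map_ofNat] at this
  let : Invertible (2 : resField v) := invertibleOfNonzero h2res
  let a' : ι → v.valuationSubring := fun i => ⟨a i, (ha i).le⟩
  set q := weightedSumSquares (resField v) fun i => res (a' i) with hq
  have hqn : q.Nondegenerate :=
    nondegenerate_weightedSumSquares fun i => (residue_ne_zero_iff' v (a' i)).2 (ha i)
  obtain ⟨W₀, hW₀, hdim⟩ := exists_isotropic_subspace (fun d hd f => hN.not_anisotropic hd f) hqn
  obtain ⟨h⟩ := exists_isometry_hyperbolicForm_of_isotropic hqn hW₀ (m := M) (by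
    rw [finrank_pi] at hdim
    omega)
  -- the standard basis of the hyperbolic form and its images
  let E : Fin M × Fin 2 → (Fin M → Fin 2 → resField v) := fun p => Pi.single p.1 (Pi.single p.2 1)
  have hdiag : ∀ x y, diagBilin (fun i => res (a' i)) (h x) (h y) =
      ∑ i, (x i 0 * y i 0 - x i 1 * y i 1) := fun x y => by
    have := (polar_weightedSumSquares (fun i => res (a' i)) (h x) (h y)).symm.trans
      (polar_eq_of_isometry h x y)
    rw [polar_hyperbolicForm] at this
    exact mul_left_cancel₀ h2res this
  have hE : ∀ p p', p ≠ p' → diagBilin (fun i => res (a' i)) (h (E p)) (h (E p')) = 0 := by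
    rintro ⟨i, j⟩ ⟨i', j'⟩ hp
    rw [hdiag, Finset.sum_eq_single i
      (fun l _ hl => by simp [E, Pi.single_eq_of_ne hl]) (by simp)]
    by_cases hi : i = i'
    · subst hi
      have hj : j ≠ j' := fun h => hp (by rw [h])
      fin_cases j <;> fin_cases j' <;> simp_all [E]
    · simp [E, Pi.single_eq_of_ne hi]
  have hE0 : ∀ i, diagBilin (fun i => res (a' i)) (h (E (i, 0))) (h (E (i, 0))) = 1 := fun i => by
    rw [hdiag, Finset.sum_eq_single i
      (fun l _ hl => by simp [E, Pi.single_eq_of_ne hl]) (by simp)]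
    simp [E]
  have hE1 : ∀ i, diagBilin (fun i => res (a' i)) (h (E (i, 1))) (h (E (i, 1))) = -1 := fun i => by
    rw [hdiag, Finset.sum_eq_single i
      (fun l _ hl => by simp [E, Pi.single_eq_of_ne hl]) (by simp)]
    simp [E]
  -- their lifts are orthogonal modulo the maximal ideal
  choose L hL using fun p i => IsLocalRing.residue_surjective (h (E p) i)
  have hLB : ∀ p p', res (∑ i, a' i * L p i * L p' i) =
      diagBilin (fun i => res (a' i)) (h (E p)) (h (E p')) := fun p p' => by
    simp [diagBilin_apply, hL, hres]
  let e := Fintype.equivFin (Fin M × Fin 2)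
  let l : Fin M × Fin 2 → ι → k := fun p i => L p i
  have hlB : ∀ p p', diagBilin a (l p) (l p') =
      ((∑ i, a' i * L p i * L p' i : v.valuationSubring) : k) := fun p p' => by
    simp [diagBilin_apply, l, a']
  obtain ⟨w, hw1, hw2, -⟩ := exists_orthogonal_of_orthogonal_mod v (diagBilin a) (diagBilin_comm a)
    (fun n => l (e.symm n))
    (fun n => by
      rw [hlB, ← residue_ne_zero_iff', ← hres, hLB]
      obtain ⟨i, j⟩ := e.symm n
      fin_cases j
      · simp [hE0]
      · simp [hE1])
    (fun n n' hn => by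
      rw [hlB, ← residue_eq_zero_iff', ← hres, hLB]
      exact hE _ _ (fun h => hn (e.symm.injective h)))
  have hw0 : ∀ i, v (diagBilin a (w (e (i, 0))) (w (e (i, 0))) - 1) < 1 := fun i => by
    have h1 := hw2 (e (i, 0))
    have h3 : v (diagBilin a (l (i, 0)) (l (i, 0)) - 1) < 1 := by
      rw [hlB]
      have := (residue_eq_zero_iff' v (∑ j, a' j * L (i, 0) j * L (i, 0) j - 1)).1 (by
        rw [map_sub, ← hres, hLB, hE0, map_one, sub_self])
      simpa using this
    simp only [Equiv.symm_apply_apply] at h1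
    have := Valuation.map_add_lt _ h1 h3
    rwa [sub_add_sub_cancel] at this
  have hw1' : ∀ i, v (diagBilin a (w (e (i, 1))) (w (e (i, 1))) + 1) < 1 := fun i => by
    have h1 := hw2 (e (i, 1))
    have h3 : v (diagBilin a (l (i, 1)) (l (i, 1)) + 1) < 1 := by
      rw [hlB]
      have := (residue_eq_zero_iff' v (∑ j, a' j * L (i, 1) j * L (i, 1) j + 1)).1 (by
        rw [map_add, ← hres, hLB, hE1, map_one, neg_add_cancel])
      simpa using this
    simp only [Equiv.symm_apply_apply] at h1
    have := Valuation.map_add_lt _ h1 h3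
    rwa [← add_assoc, sub_add_cancel] at this
  choose s hs using fun i => exists_sq_mul_add_eq_zero v h2 (hw0 i) (hw1' i)
  set B := diagBilin fun i => algebraMap k v.Completion (a i) with hBdef
  let g : Fin M × Fin 2 → ι → v.Completion := fun p i => algebraMap k v.Completion (w (e p) i)
  have hg : ∀ p p', B (g p) (g p') = algebraMap k v.Completion (diagBilin a (w (e p)) (w (e p'))) :=
    fun p p' => diagBilin_map (algebraMap k v.Completion) a (w (e p)) (w (e p'))
  have hg0 : ∀ p p', p ≠ p' → B (g p) (g p') = 0 := fun p p' hp => by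
    rw [hg, hw1 _ _ (fun h => hp (e.injective h)), map_zero]
  -- one isotropic vector in each of the `M` orthogonal hyperbolic planes
  let t : Fin M → ι → v.Completion := fun i => s i • g (i, 0) + g (i, 1)
  have htt : ∀ i j, B (t i) (t j) = 0 := fun i j => by
    by_cases hij : i = j
    · subst hij
      have := hs i
      simp [t, hg0 (i, 0) (i, 1) (by simp), hg0 (i, 1) (i, 0) (by simp), hg]
      linear_combination this
    · simp [t, hg0 (i, _) (j, _) (by simp [hij])]
  have htg : ∀ i j, B (t i) (g (j, 1)) =
      if i = j then algebraMap k v.Completion (diagBilin a (w (e (j, 1))) (w (e (j, 1)))) else 0 :=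
    fun i j => by
    by_cases hij : i = j
    · subst hij
      simp [t, hg0 (i, 0) (i, 1) (by simp), hg]
    · simp [t, hg0 (i, _) (j, _) (by simp [hij]), hij]
  have hlin : LinearIndependent v.Completion t := by
    rw [Fintype.linearIndependent_iff]
    intro c hc j
    have h0 : B (∑ i, c i • t i) (g (j, 1)) = 0 := by rw [hc]; simp
    have hd : diagBilin a (w (e (j, 1))) (w (e (j, 1))) ≠ 0 := fun h => by
      have := hw1' j
      simp [h] at this
    simpa [LinearMap.sum_apply, htg, hd] using h0
  refine ⟨Submodule.span v.Completion (Set.range t), fun x hx => ?_, ?_⟩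
  · obtain ⟨c, rfl⟩ := (Submodule.mem_span_range_iff_exists_fun _).1 hx
    rw [← diagBilin_self, ← hBdef]
    simp [LinearMap.sum_apply, htt]
  · rw [finrank_span_eq_card hlin, Fintype.card_fin]

end Residue

/-! ### Springer's theorem -/

section Springer

open Polynomial Module

theorem exists_irreducible_dvd_odd_natDegree {k : Type*} [Field k] {h : k[X]}
    (hodd : Odd h.natDegree) : ∃ f : k[X], Irreducible f ∧ f ∣ h ∧ Odd f.natDegree := by
  induction hn : h.natDegree using Nat.strong_induction_on generalizing h with
  | _ n ih =>
    have h0 : h ≠ 0 := by rintro rfl; simp at hodd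
    have hu : ¬ IsUnit h := fun hu => by
      rw [natDegree_eq_zero_of_isUnit hu] at hodd; simp at hodd
    obtain ⟨f, hf, g, rfl⟩ := WfDvdMonoid.exists_irreducible_factor hu h0
    by_cases hfo : Odd f.natDegree
    · exact ⟨f, hf, dvd_mul_right _ _, hfo⟩
    · have hg0 : g ≠ 0 := right_ne_zero_of_mul h0
      have hdeg := natDegree_mul hf.ne_zero hg0
      have hfpos : 0 < f.natDegree := hf.natDegree_pos
      rw [hdeg, Nat.odd_add'] at hodd
      have hgo := hodd.2 (Nat.not_odd_iff_even.1 hfo)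
      obtain ⟨f', h1, h2, h3⟩ := ih _ (by omega) hgo rfl
      exact ⟨f', h1, h2.mul_left _, h3⟩

variable {ι : Type*} [Fintype ι]

/-- An anisotropic diagonal form stays anisotropic modulo an irreducible polynomial of odd degree.
A primitive zero of degree less than that of `p` leaves, after division by `p`, a cofactor of
smaller odd degree. -/
theorem dvd_of_dvd_sum_sq {k : Type*} [Field k] {a : ι → k}
    (ha : ∀ x : ι → k, ∑ i, a i * x i ^ 2 = 0 → x = 0) {p : k[X]} (hp : Irreducible p)
    (hodd : Odd p.natDegree) {g : ι → k[X]} (hg : p ∣ ∑ i, C (a i) * g i ^ 2) (i : ι) :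
    p ∣ g i := by
  classical
  induction hn : p.natDegree using Nat.strong_induction_on generalizing p g i with
  | _ n ih =>
    by_contra hi
    let : NormalizedGCDMonoid k[X] := Classical.choice inferInstance
    -- `g` is replaced by its remainder modulo `p`, then divided by the common divisor `c`
    set g₁ : ι → k[X] := fun j => g j % p with hg₁
    have hmod : ∀ j, p ∣ g j - g₁ j := fun j => by
      simp [hg₁, EuclideanDomain.mod_eq_sub_mul_div]
    have hi₁ : g₁ i ≠ 0 := fun h => hi (by simpa [h] using hmod i)
    have hlt : ∀ j, (g₁ j).natDegree < n := fun j => by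
      rw [← hn]
      exact natDegree_mod_lt _ hp.natDegree_pos.ne'
    have hdvd₁ : p ∣ ∑ j, C (a j) * g₁ j ^ 2 := by
      have : p ∣ ∑ j, C (a j) * g j ^ 2 - ∑ j, C (a j) * g₁ j ^ 2 := by
        rw [← Finset.sum_sub_distrib]
        refine Finset.dvd_sum fun j _ => ?_
        rw [← mul_sub, sq_sub_sq]
        exact ((hmod j).mul_left _).mul_left _
      exact (dvd_sub_right hg).1 this
    obtain ⟨g₂, hg₂, hgcd⟩ := Finset.extract_gcd g₁ (s := Finset.univ) ⟨i, Finset.mem_univ i⟩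
    set c := Finset.univ.gcd g₁ with hc
    have hfac : ∀ j, g₁ j = c * g₂ j := fun j => hg₂ j (Finset.mem_univ j)
    have hc0 : c ≠ 0 := by rintro h; apply hi₁; rw [hfac, h, zero_mul]
    have hg₂i : g₂ i ≠ 0 := by rintro h; apply hi₁; rw [hfac, h, mul_zero]
    have hpc : ¬ p ∣ c := fun h => by
      have h1 := natDegree_le_of_dvd (h.trans (Dvd.intro _ (hfac i).symm)) hi₁
      have h2 := hlt i
      omega
    have hlt₂ : ∀ j, (g₂ j).natDegree < n := fun j => by
      by_cases hj : g₂ j = 0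
      · rw [hj, natDegree_zero, ← hn]; exact hp.natDegree_pos
      · refine lt_of_le_of_lt ?_ (hlt j)
        rw [hfac, natDegree_mul hc0 hj]
        omega
    have hdvd₂ : p ∣ ∑ j, C (a j) * g₂ j ^ 2 := by
      have : ∑ j, C (a j) * g₁ j ^ 2 = c ^ 2 * ∑ j, C (a j) * g₂ j ^ 2 := by
        rw [Finset.mul_sum]
        refine Finset.sum_congr rfl fun j _ => ?_
        rw [hfac]; ring
      rw [this] at hdvd₁
      exact (hp.prime.dvd_or_dvd hdvd₁).resolve_left fun h => hpc (hp.prime.dvd_of_dvd_pow h)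
    -- by anisotropy the leading coefficients cannot cancel
    have : Nonempty ι := ⟨i⟩
    obtain ⟨j, hj⟩ := Finite.exists_max fun j => (g₂ j).degree
    have hg₂j : g₂ j ≠ 0 := fun h => by
      have h1 := hj i
      simp only [h, degree_zero, le_bot_iff, degree_eq_bot] at h1
      exact hg₂i h1
    set m := (g₂ j).natDegree with hm
    have hle : ∀ l, (g₂ l).natDegree ≤ m := fun l => natDegree_le_natDegree (hj l)
    set S := ∑ j, C (a j) * g₂ j ^ 2 with hS
    have hcoeff : S.coeff (2 * m) ≠ 0 := fun h => by
      rw [hS, finsetSum_coeff] at h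
      simp only [coeff_C_mul, coeff_pow_of_natDegree_le (hle _)] at h
      have := congrFun (ha (fun l => (g₂ l).coeff m) h) j
      exact hg₂j (leadingCoeff_eq_zero.1 this)
    have hdegS : S.natDegree = 2 * m := by
      refine le_antisymm ?_ (le_natDegree_of_ne_zero hcoeff)
      refine natDegree_sum_le_of_forall_le _ _ fun l _ => ?_
      exact (natDegree_C_mul_le _ _).trans (natDegree_pow_le_of_le 2 (hle l))
    obtain ⟨h, hh⟩ := hdvd₂
    have hS0 : S ≠ 0 := by rintro h0; simp [h0] at hcoeff
    have hh0 : h ≠ 0 := right_ne_zero_of_mul (hh ▸ hS0)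
    have hdeg := natDegree_mul hp.ne_zero hh0
    rw [← hh, hdegS, hn] at hdeg
    have hmn : m < n := hlt₂ j
    rw [hn] at hodd
    -- the sum has even degree `2 * m < 2 * n`, so `h` has odd degree less than `n`
    have hho : Odd h.natDegree := by
      rcases hodd with ⟨b, hb⟩
      rw [Nat.odd_iff]
      omega
    obtain ⟨f, hf, hfh, hfo⟩ := exists_irreducible_dvd_odd_natDegree hho
    have hfn : f.natDegree < n := by
      have := natDegree_le_of_dvd hfh hh0
      omega
    have hfg : ∀ l, f ∣ g₂ l := fun l =>
      ih _ hfn hf hfo (g := g₂) ((hfh.mul_left p).trans (dvd_of_eq hh.symm)) l rfl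
    -- an irreducible factor of `h` of odd degree would divide the coprime entries of `g₂`
    have : f ∣ 1 := hgcd ▸ Finset.dvd_gcd fun l _ => hfg l
    exact hf.not_isUnit (isUnit_of_dvd_one this)

open IntermediateField in
/-- Springer's theorem for a simple extension `k(α) = k[X] / (p)`, with `p` the minimal polynomial
of `α`. -/
theorem anisotropic_adjoin_simple {k K : Type*} [Field k] [Field K] [Algebra k K] {α : K}
    (hα : IsIntegral k α) (hodd : Odd (minpoly k α).natDegree) {a : ι → k}
    (ha : ∀ x : ι → k, ∑ i, a i * x i ^ 2 = 0 → x = 0) (x : ι → k⟮α⟯)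
    (hx : ∑ i, algebraMap k k⟮α⟯ (a i) * x i ^ 2 = 0) : x = 0 := by
  choose g hg using fun i => (adjoin.powerBasis hα).exists_eq_aeval' (x i)
  have hgen : minpoly k (adjoin.powerBasis hα).gen = minpoly k α := by
    rw [adjoin.powerBasis_gen, minpoly_gen]
  have hdvd : minpoly k α ∣ ∑ i, C (a i) * g i ^ 2 := by
    rw [← hgen]
    apply minpoly.dvd
    simpa [hg] using hx
  ext1 i
  obtain ⟨h, hh⟩ := dvd_of_dvd_sum_sq ha (minpoly.irreducible hα) hodd hdvd i
  rw [hg, hh, map_mul, ← hgen, minpoly.aeval, zero_mul]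
  rfl

open IntermediateField in
/-- **Springer's theorem** for diagonal forms: anisotropy is preserved by field extensions of odd
degree. -/
theorem anisotropic_of_odd_finrank {k K : Type u} [Field k] [Field K] [Algebra k K]
    (hodd : Odd (finrank k K)) {a : ι → k}
    (ha : ∀ x : ι → k, ∑ i, a i * x i ^ 2 = 0 → x = 0) (x : ι → K)
    (hx : ∑ i, algebraMap k K (a i) * x i ^ 2 = 0) : x = 0 := by
  induction hn : finrank k K using Nat.strong_induction_on generalizing k with
  | _ n ih =>
    have hfin : FiniteDimensional k K := FiniteDimensional.of_finrank_pos hodd.pos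
    by_cases htop : (⊥ : IntermediateField k K) = ⊤
    · have hsurj : ∀ y : K, ∃ b, algebraMap k K b = y := fun y => by
        have : y ∈ (⊥ : IntermediateField k K) := htop ▸ mem_top
        exact mem_bot.1 this
      choose b hb using fun i => hsurj (x i)
      have h0 := ha b (by
        apply (algebraMap k K).injective
        simpa [hb] using hx)
      ext1 i
      rw [← hb, h0]
      simp
    · obtain ⟨α, hα⟩ : ∃ α : K, α ∉ (⊥ : IntermediateField k K) := by
        by_contra! h
        exact htop (eq_top_iff.2 fun y _ => h y)
      have hint : IsIntegral k α := IsIntegral.of_finite k α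
      have hmul := finrank_mul_finrank k k⟮α⟯ K
      rw [← hmul, Nat.odd_mul] at hodd
      have h1 : finrank k k⟮α⟯ ≠ 1 := fun h => hα (finrank_adjoin_simple_eq_one_iff.1 h)
      have h1' := hodd.1.pos
      have h2' := hodd.2.pos
      refine ih (finrank k⟮α⟯ K) ?_ hodd.2 (a := fun i => algebraMap k k⟮α⟯ (a i))
        (anisotropic_adjoin_simple hint (by rw [← adjoin.finrank hint]; exact hodd.1) ha) ?_ rfl
      · rw [← hn, ← hmul]
        exact lt_mul_left h2' (by omega)
      · simpa [← IsScalarTower.algebraMap_apply] using hx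

end Springer

/-! ### Forms over rational function fields -/

section TsenLang

open MvPolynomial Module

variable {r d N m : ℕ}

/-- The polynomial in `r` variables with undetermined coefficients `T e`, of degree less than `N`
in each variable. -/
def boxPoly (K : Type*) [CommRing K] (r N : ℕ) :
    ((Fin r → Fin N) → K) →ₗ[K] MvPolynomial (Fin r) K :=
  ∑ e : Fin r → Fin N,
    (monomial (Finsupp.equivFunOnFinite.symm fun t => (e t : ℕ))).comp (LinearMap.proj e)

theorem boxPoly_apply {K : Type*} [CommRing K] (T : (Fin r → Fin N) → K) :
    boxPoly K r N T =
      ∑ e, monomial (Finsupp.equivFunOnFinite.symm fun t => (e t : ℕ)) (T e) := by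
  simp [boxPoly, LinearMap.sum_apply]

theorem coeff_boxPoly {K : Type*} [CommRing K] (T : (Fin r → Fin N) → K) (e : Fin r → Fin N) :
    coeff (Finsupp.equivFunOnFinite.symm fun t => (e t : ℕ)) (boxPoly K r N T) = T e := by
  classical
  rw [boxPoly_apply, coeff_sum, Finset.sum_eq_single e]
  · simp
  · intro e' _ he
    rw [coeff_monomial, if_neg]
    intro h
    apply he
    ext t
    exact DFunLike.congr_fun h t
  · simp

theorem degreeOf_boxPoly_lt {K : Type*} [CommRing K] (T : (Fin r → Fin N) → K) (t : Fin r)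
    (hN : 0 < N) : degreeOf t (boxPoly K r N T) < N := by
  rw [boxPoly_apply]
  refine (degreeOf_sum_le _ _ _).trans_lt ?_
  rw [Finset.sup_lt_iff (by simpa)]
  intro e _
  by_cases h : T e = 0
  · simpa [h] using hN
  · simp [degreeOf_monomial_eq _ _ h]

theorem map_boxPoly {K L : Type*} [CommRing K] [CommRing L] (f : K →+* L)
    (T : (Fin r → Fin N) → K) :
    map f (boxPoly K r N T) = boxPoly L r N fun e => f (T e) := by
  simp [boxPoly_apply]

/-- The coefficient at the monomial `g` of `∑ pⱼ fⱼ²`, as a quadratic form in the coefficients of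
the polynomials `fⱼ`. -/
def coeffForm {K : Type*} [CommRing K] (N : ℕ) (p : Fin d → MvPolynomial (Fin r) K)
    (g : Fin r →₀ ℕ) : QuadraticForm K (Fin d × (Fin r → Fin N) → K) :=
  ∑ j, (LinearMap.BilinMap.toQuadraticMap ((LinearMap.mul K (MvPolynomial (Fin r) K)).compr₂
    ((lcoeff K g).comp (LinearMap.mulLeft K (p j))))).comp
    ((boxPoly K r N).comp (LinearMap.funLeft K K fun e => (j, e)))

theorem coeffForm_apply {K : Type*} [CommRing K] (p : Fin d → MvPolynomial (Fin r) K)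
    (g : Fin r →₀ ℕ) (T : Fin d × (Fin r → Fin N) → K) :
    coeffForm N p g T = coeff g (∑ j, p j * boxPoly K r N (fun e => T (j, e)) ^ 2) := by
  simp only [coeffForm, _root_.sum_apply, coeff_sum, pow_two]
  rfl

/-- The numbers of unknown coefficients of `d` polynomials and of coefficients of the resulting sum:
for `N` large there are more than `2 ^ i` unknowns for each equation. -/
theorem exists_box_size {i : ℕ} (m : ℕ) (hd : 2 ^ (i + r) < d) :
    ∃ N, 0 < N ∧ (2 * N + m) ^ r * 2 ^ i < d * N ^ r := by
  -- `((2 * N + m) / N) ^ r` tends to `2 ^ r` as `N` grows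
  have hlim : Filter.Tendsto (fun N : ℕ => (2 + (m : ℝ) / N) ^ r * 2 ^ i) Filter.atTop
      (nhds ((2 + 0) ^ r * 2 ^ i)) :=
    (((tendsto_const_div_atTop_nhds_zero_nat (m : ℝ)).const_add 2).pow r).mul_const _
  have hlt : ((2 : ℝ) + 0) ^ r * 2 ^ i < d := by
    rw [add_zero, ← pow_add, add_comm]
    exact_mod_cast hd
  obtain ⟨N, hN, hN0⟩ := ((hlim.eventually_lt_const hlt).and (Filter.eventually_gt_atTop 0)).exists
  refine ⟨N, hN0, ?_⟩
  have hN' : (0 : ℝ) < N := by exact_mod_cast hN0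
  have h : ((2 * N + m : ℝ)) ^ r * 2 ^ i < d * N ^ r := by
    have := mul_lt_mul_of_pos_right hN (pow_pos hN' r)
    rw [mul_right_comm, ← mul_pow] at this
    rwa [show (2 * N + m : ℝ) = (2 + m / N) * N by field_simp]
  exact_mod_cast h

/-- Property `𝒜ᵢ(2)` for `ℓ` bounds the dimension of anisotropic forms over `ℓ(x₁, …, xᵣ)`:
comparing coefficients turns a diagonal form into a system of quadratic forms over `ℓ`, whose zero
over an extension of odd degree descends by Springer's theorem. -/
theorem exists_ne_zero_of_propertyA2 {ℓ : Type u} [Field ℓ] [Invertible (2 : ℓ)] {i : ℕ}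
    (hA : PropertyA2 ℓ i) (hd : 2 ^ (i + r) < d) (p : Fin d → MvPolynomial (Fin r) ℓ) :
    ∃ x : Fin d → RatField ℓ r, x ≠ 0 ∧
      ∑ j, algebraMap _ (RatField ℓ r) (p j) * x j ^ 2 = 0 := by
  classical
  by_contra! hcon
  have haniso : ∀ x : Fin d → RatField ℓ r,
      ∑ j, algebraMap _ (RatField ℓ r) (p j) * x j ^ 2 = 0 → x = 0 := fun x hx => by
    by_contra h
    exact hcon x h hx
  set m := (∑ j, (p j).totalDegree) + 1 with hm
  have hpm : ∀ j t, degreeOf t (p j) < m := fun j t =>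
    Nat.lt_succ_of_le ((degreeOf_le_totalDegree _ _).trans
      (Finset.single_le_sum (f := fun j => (p j).totalDegree) (fun _ _ => Nat.zero_le _)
        (Finset.mem_univ j)))
  obtain ⟨N, hN0, hN⟩ := exists_box_size m hd
  let G := Fin r → Fin (2 * N + m)
  let toG : G → (Fin r →₀ ℕ) := fun g => Finsupp.equivFunOnFinite.symm fun t => (g t : ℕ)
  let I := Fin d × (Fin r → Fin N)
  let eG := Fintype.equivFin G
  let eI := Fintype.equivFin I
  obtain ⟨K, _, _, hodd, z, hz0, hz⟩ := hA (Fintype.card G) (Fintype.card I)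
    (fun s => (coeffForm N p (toG (eG.symm s))).comp
      (LinearEquiv.funCongrLeft ℓ ℓ eI).toLinearMap)
    (by simpa [G, I] using hN)
  have : Invertible (2 : K) := (Invertible.map (algebraMap ℓ K) 2).copy 2 (map_ofNat _ _).symm
  set P : Fin d → MvPolynomial (Fin r) K := fun j => map (algebraMap ℓ K) (p j) with hP
  -- the coefficients of the zero found over `K`
  set T : I → K := LinearEquiv.funCongrLeft K K eI
    (TensorProduct.piScalarRight ℓ K K (Fin (Fintype.card I)) z) with hT
  have hT0 : T ≠ 0 := by
    rw [hT, ne_eq, LinearEquiv.map_eq_zero_iff, LinearEquiv.map_eq_zero_iff]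
    exact hz0
  have hcoeff : ∀ g : G, coeff (toG g) (∑ j, P j * boxPoly K r N (fun e => T (j, e)) ^ 2) = 0 := by
    intro g
    have h1 := hz (eG g)
    rw [Equiv.symm_apply_apply] at h1
    have h2 : QuadraticForm.baseChange K ((coeffForm N p (toG g)).comp
        (LinearEquiv.funCongrLeft ℓ ℓ eI).toLinearMap) =
        (coeffForm N P (toG g)).comp ((LinearEquiv.funCongrLeft K K eI).toLinearMap ∘ₗ
          (TensorProduct.piScalarRight ℓ K K (Fin (Fintype.card I))).toLinearMap) := by
      refine baseChange_ext fun x => ?_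
      rw [QuadraticForm.baseChange_tmul, QuadraticMap.comp_apply, QuadraticMap.comp_apply]
      have h3 : ((LinearEquiv.funCongrLeft K K eI).toLinearMap ∘ₗ
          (TensorProduct.piScalarRight ℓ K K (Fin (Fintype.card I))).toLinearMap) (1 ⊗ₜ[ℓ] x) =
          fun q => algebraMap ℓ K (x (eI q)) := by
        ext q
        simp [LinearEquiv.funCongrLeft, LinearMap.funLeft_apply, Algebra.smul_def]
      rw [h3, coeffForm_apply, coeffForm_apply, mul_one, Algebra.smul_def, mul_one, ← coeff_map]
      simp only [map_sum, map_mul, map_pow, map_boxPoly]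
      rfl
    rw [h2] at h1
    rw [← coeffForm_apply]
    exact h1
  have hsum : ∑ j, P j * boxPoly K r N (fun e => T (j, e)) ^ 2 = 0 := by
    ext g
    rw [coeff_zero]
    by_cases hg : ∀ t, g t < 2 * N + m
    · have := hcoeff fun t => ⟨g t, hg t⟩
      rwa [show toG (fun t => ⟨g t, hg t⟩) = g by ext t; rfl] at this
    · push Not at hg
      obtain ⟨t, ht⟩ := hg
      by_contra hne
      have h1 := le_degreeOf_of_mem_support (i := t) (mem_support_iff.2 hne)
      have h2 : degreeOf t (∑ j, P j * boxPoly K r N (fun e => T (j, e)) ^ 2) < 2 * N + m := by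
        refine (degreeOf_sum_le _ _ _).trans_lt ?_
        rw [Finset.sup_lt_iff (by simp; omega)]
        intro j _
        have h3 := degreeOf_mul_le t (P j) (boxPoly K r N (fun e => T (j, e)) ^ 2)
        have h4 := degreeOf_pow_le t (boxPoly K r N (fun e => T (j, e))) 2
        have h5 := degreeOf_boxPoly_lt (fun e => T (j, e)) t hN0
        have h6 : degreeOf t (P j) ≤ degreeOf t (p j) := by
          rw [degreeOf_eq_sup, degreeOf_eq_sup]
          exact Finset.sup_mono (support_map_subset _ _)
        have h7 := hpm j t
        omega
      omega
  -- `K(x₁, …, xᵣ)` has the same odd degree over `ℓ(x₁, …, xᵣ)` as `K` over `ℓ`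
  let _ : Algebra (MvPolynomial (Fin r) ℓ) (MvPolynomial (Fin r) K) := algebraMvPolynomial
  let _ : Algebra (RatField ℓ r) (RatField K r) := FractionRing.liftAlgebra _ _
  have hfin : FiniteDimensional ℓ K := FiniteDimensional.of_finrank_pos hodd.pos
  have hodd' : Odd (finrank (RatField ℓ r) (RatField K r)) := by
    have := Algebra.IsAlgebraic.rank_fractionRing_mvPolynomial (R := ℓ) (S := K) (Fin r)
    have h := congrArg Cardinal.toNat this
    rw [Cardinal.toNat_lift] at h
    rw [finrank, h]
    exact hodd
  have h0 := anisotropic_of_odd_finrank hodd' haniso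
    (fun j => algebraMap _ (RatField K r) (boxPoly K r N fun e => T (j, e))) (by
      rw [← map_zero (algebraMap (MvPolynomial (Fin r) K) (RatField K r)), ← hsum, map_sum]
      refine Finset.sum_congr rfl fun j _ => ?_
      rw [map_mul, map_pow, ← IsScalarTower.algebraMap_apply,
        IsScalarTower.algebraMap_apply _ (MvPolynomial (Fin r) K) (RatField K r)]
      rfl)
  apply hT0
  ext ⟨j, e⟩
  have h1 : boxPoly K r N (fun e => T (j, e)) = 0 :=
    (IsFractionRing.injective (MvPolynomial (Fin r) K) (RatField K r))
      ((congrFun h0 j).trans (map_zero _).symm)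
  rw [← coeff_boxPoly (fun e => T (j, e)) e, h1, coeff_zero]
  rfl

/-- Property `𝒜ᵢ(2)` for `ℓ` gives `u(ℓ(x₁, …, xᵣ)) ≤ 2 ^ (i + r)`. Multiplying each entry by the
square of its denominator reduces this to polynomial entries. -/
theorem isotropicAbove_ratField {ℓ : Type u} [Field ℓ] [Invertible (2 : ℓ)] {i : ℕ}
    (hA : PropertyA2 ℓ i) (r : ℕ) : IsotropicAbove (RatField ℓ r) (2 ^ (i + r)) := by
  intro d hd a
  choose b c hc habc using fun j =>
    IsFractionRing.div_surjective (A := MvPolynomial (Fin r) ℓ) (a j)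
  have hc0 : ∀ j, algebraMap _ (RatField ℓ r) (c j) ≠ 0 := fun j =>
    IsFractionRing.to_map_ne_zero_of_mem_nonZeroDivisors (hc j)
  obtain ⟨x, hx0, hx⟩ := exists_ne_zero_of_propertyA2 hA hd fun j => b j * c j
  refine ⟨fun j => algebraMap _ (RatField ℓ r) (c j) * x j, fun h => hx0 ?_, ?_⟩
  · ext j
    exact (mul_eq_zero.1 (congrFun h j)).resolve_left (hc0 j)
  · rw [← hx]
    refine Finset.sum_congr rfl fun j _ => ?_
    rw [← habc, map_mul]
    field_simp [hc0 j]

end TsenLang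

/-! ### Lowest terms of power series -/

section LowestTerm

open MvPowerSeries

variable {ℓ : Type*} [Field ℓ] {σ : Type*} [LinearOrder σ] [WellFoundedGT σ]

theorem coeff_add_self_mul_self {f : MvPowerSeries σ ℓ} {m : σ →₀ ℕ}
    (hm : ((toLex m : Lex (σ →₀ ℕ)) : WithTop (Lex (σ →₀ ℕ))) ≤ lexOrder f) :
    coeff (m + m) (f * f) = coeff m f * coeff m f := by
  rcases hm.eq_or_lt with h | h
  · exact coeff_mul_of_add_lexOrder h.symm h.symm
  · rw [coeff_eq_zero_of_lt_lexOrder h, zero_mul]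
    refine coeff_eq_zero_of_lt_lexOrder (lt_of_lt_of_le ?_ (le_lexOrder_mul f f))
    rw [toLex_add, WithTop.coe_add]
    exact WithTop.add_lt_add h h

/-- The lowest term of a value of an anisotropic form is a value of that form, multiplied by the
square of a monomial. -/
theorem exists_lexOrder_sum_sq {ι : Type*} [Fintype ι] {c : ι → ℓ}
    (hc : ∀ x : ι → ℓ, ∑ i, c i * x i ^ 2 = 0 → x = 0) {f : ι → MvPowerSeries σ ℓ} (hf : f ≠ 0) :
    ∃ m : σ →₀ ℕ, lexOrder (∑ i, C (c i) * f i ^ 2) = toLex (m + m) := by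
  obtain ⟨i₀, hi₀⟩ := Function.ne_iff.1 hf
  have : Nonempty ι := ⟨i₀⟩
  obtain ⟨i, hi⟩ := Finite.exists_min fun i => lexOrder (f i)
  have hfi : f i ≠ 0 := fun h => by
    have := hi i₀
    rw [h, lexOrder_zero, top_le_iff, lexOrder_eq_top_iff_eq_zero] at this
    exact hi₀ this
  obtain ⟨m, hm⟩ := exists_finsupp_eq_lexOrder_of_ne_zero hfi
  have hle : ∀ j, ((toLex m : Lex (σ →₀ ℕ)) : WithTop (Lex (σ →₀ ℕ))) ≤ lexOrder (f j) :=
    fun j => hm ▸ hi j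
  refine ⟨m, le_antisymm (lexOrder_le_of_coeff_ne_zero fun h => ?_) (le_lexOrder_iff.2 ?_)⟩
  · simp only [map_sum, coeff_C_mul, pow_two, coeff_add_self_mul_self (hle _)] at h
    have := congrFun (hc (fun j => coeff m (f j)) (by simpa [pow_two] using h)) i
    exact coeff_ne_zero_of_lexOrder hm.symm this
  · intro d hd
    rw [map_sum]
    refine Finset.sum_eq_zero fun j _ => ?_
    rw [coeff_C_mul, pow_two, coeff_eq_zero_of_lt_lexOrder, mul_zero]
    refine hd.trans_le (le_trans ?_ (le_lexOrder_mul (f j) (f j)))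
    rw [toLex_add, WithTop.coe_add]
    exact add_le_add (hle j) (hle j)

/-- If the orders of the weights `w a` are distinct modulo two, the orthogonal sum of the multiples
by the `w a` of an anisotropic form with constant coefficients is anisotropic. -/
theorem eq_zero_of_sum_weights_mul_sq {A ι : Type*} [Fintype A] [Fintype ι] {c : ι → ℓ}
    (hc : ∀ x : ι → ℓ, ∑ i, c i * x i ^ 2 = 0 → x = 0) {w : A → MvPowerSeries σ ℓ}
    {γ : A → σ →₀ ℕ} (hw : ∀ a, lexOrder (w a) = toLex (γ a))
    (hγ : ∀ a b (m m' : σ →₀ ℕ), γ a + (m + m) = γ b + (m' + m') → a = b)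
    {f : A → ι → MvPowerSeries σ ℓ} (hf : ∑ a, w a * ∑ i, C (c i) * f a i ^ 2 = 0) : f = 0 := by
  by_contra hf0
  obtain ⟨a₀, ha₀⟩ := Function.ne_iff.1 hf0
  have : Nonempty A := ⟨a₀⟩
  set g : A → MvPowerSeries σ ℓ := fun a => w a * ∑ i, C (c i) * f a i ^ 2 with hg
  have hga : ∀ a, f a ≠ 0 → ∃ m : σ →₀ ℕ, lexOrder (g a) = toLex (γ a + (m + m)) := fun a ha => by
    obtain ⟨m, hm⟩ := exists_lexOrder_sum_sq hc ha
    refine ⟨m, ?_⟩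
    rw [hg, lexOrder_mul, hw, hm, toLex_add (γ a), WithTop.coe_add]
  have hg0 : ∀ a, g a ≠ 0 → f a ≠ 0 := fun a ha h => ha (by simp [hg, h])
  obtain ⟨a, ha⟩ := Finite.exists_min fun a => lexOrder (g a)
  have hgane : g a ≠ 0 := fun h => by
    obtain ⟨m, hm⟩ := hga a₀ ha₀
    have := ha a₀
    rw [h, lexOrder_zero, top_le_iff, hm] at this
    exact WithTop.coe_ne_top this
  obtain ⟨m, hm⟩ := hga a (hg0 a hgane)
  -- the lowest term of `g a` is not met by that of any other summand
  have h := congrArg (coeff (γ a + (m + m))) hf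
  rw [map_sum, Finset.sum_eq_single a] at h
  · exact coeff_ne_zero_of_lexOrder hm.symm h
  · intro b _ hb
    apply coeff_eq_zero_of_lt_lexOrder
    rw [← hm]
    refine lt_of_le_of_ne (ha b) fun heq => ?_
    have hgb : g b ≠ 0 := fun h0 => by
      have h0' : lexOrder (g b) = ⊤ := by rw [h0, lexOrder_zero]
      rw [h0', hm] at heq
      exact WithTop.coe_ne_top heq
    obtain ⟨m', hm'⟩ := hga b (hg0 b hgb)
    rw [hm, hm', WithTop.coe_inj] at heq
    exact hb (hγ b a m' m (toLex.injective heq).symm)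
  · simp

/-- The same over the field of fractions of the polynomial ring, after clearing denominators. -/
theorem eq_zero_of_sum_weights_mul_sq_fractionRing {A ι : Type*} [Fintype A] [Fintype ι]
    {c : ι → ℓ} (hc : ∀ x : ι → ℓ, ∑ i, c i * x i ^ 2 = 0 → x = 0) {w : A → MvPolynomial σ ℓ}
    {γ : A → σ →₀ ℕ} (hw : ∀ a, lexOrder (w a : MvPowerSeries σ ℓ) = toLex (γ a))
    (hγ : ∀ a b (m m' : σ →₀ ℕ), γ a + (m + m) = γ b + (m' + m') → a = b)
    {F : Type*} [Field F] [Algebra (MvPolynomial σ ℓ) F] [IsFractionRing (MvPolynomial σ ℓ) F]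
    {y : A → ι → F} (hy : ∑ a, algebraMap (MvPolynomial σ ℓ) F (w a) *
      ∑ i, algebraMap (MvPolynomial σ ℓ) F (MvPolynomial.C (c i)) * y a i ^ 2 = 0) : y = 0 := by
  obtain ⟨⟨b, hb⟩, hbs⟩ := IsLocalization.exist_integer_multiples_of_finite
    (nonZeroDivisors (MvPolynomial σ ℓ)) fun p : A × ι => y p.1 p.2
  choose f hf using hbs
  have hb0 : algebraMap (MvPolynomial σ ℓ) F b ≠ 0 :=
    IsFractionRing.to_map_ne_zero_of_mem_nonZeroDivisors hb
  have hf' : ∀ a i, algebraMap (MvPolynomial σ ℓ) F (f (a, i)) =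
      algebraMap (MvPolynomial σ ℓ) F b * y a i := fun a i => by
    rw [hf, Algebra.smul_def]
  have hsum : ∑ a, w a * ∑ i, MvPolynomial.C (c i) * f (a, i) ^ 2 = 0 := by
    apply IsFractionRing.injective (MvPolynomial σ ℓ) F
    rw [map_zero, ← mul_zero (algebraMap (MvPolynomial σ ℓ) F b ^ 2), ← hy, Finset.mul_sum]
    simp only [map_sum, map_mul, map_pow, hf', Finset.mul_sum]
    refine Finset.sum_congr rfl fun a _ => Finset.sum_congr rfl fun i _ => ?_
    ring
  have h0 := eq_zero_of_sum_weights_mul_sq hc (w := fun a => (w a : MvPowerSeries σ ℓ)) hw hγ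
    (f := fun a i => (f (a, i) : MvPowerSeries σ ℓ)) (by
      have := congrArg (MvPolynomial.coeToMvPowerSeries.ringHom (σ := σ) (R := ℓ)) hsum
      simp only [map_sum, map_mul, map_pow] at this
      simpa [MvPolynomial.coeToMvPowerSeries.ringHom_apply] using this)
  ext a i
  have h1 : (f (a, i) : MvPowerSeries σ ℓ) = 0 := congrFun (congrFun h0 a) i
  have h2 : f (a, i) = 0 := by exact_mod_cast h1
  have h3 := hf' a i
  rw [h2, map_zero] at h3
  exact (mul_eq_zero.1 h3.symm).resolve_left hb0

end LowestTerm

/-! ### Diagonalization of tensor products and base changes -/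

section TensorDiagonal

open QuadraticMap Module

variable {k : Type*} [Field k] [Invertible (2 : k)]

theorem isOrthoᵢ_tmul {M N : Type*} [AddCommGroup M] [Module k M] [AddCommGroup N] [Module k N]
    {ι κ : Type*} {q : QuadraticForm k M} {q' : QuadraticForm k N} {b : Basis ι k M}
    {b' : Basis κ k N} (hb : (associated (R := k) q).IsOrthoᵢ b)
    (hb' : (associated (R := k) q').IsOrthoᵢ b') :
    (associated (R := k) (QuadraticForm.tmul q q')).IsOrthoᵢ (b.tensorProduct b') := by
  rintro ⟨i, j⟩ ⟨i', j'⟩ hij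
  rw [Function.onFun, Basis.tensorProduct_apply, Basis.tensorProduct_apply,
    QuadraticForm.associated_tmul, LinearMap.BilinForm.tensorDistrib_tmul]
  by_cases hi : i = i'
  · have hj : j ≠ j' := fun h => hij (by rw [hi, h])
    have := hb' hj
    rw [Function.onFun] at this
    rw [this, zero_smul]
  · have := hb hi
    rw [Function.onFun] at this
    rw [this, smul_zero]

theorem isOrthoᵢ_baseChange {M : Type*} [AddCommGroup M] [Module k M] {ι : Type*}
    {q : QuadraticForm k M} {b : Basis ι k M} (hb : (associated (R := k) q).IsOrthoᵢ b)
    (K : Type*) [Field K] [Algebra k K] [Invertible (2 : K)] :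
    (associated (R := K) (q.baseChange K)).IsOrthoᵢ (b.baseChange K) := by
  intro i j hij
  have := hb hij
  rw [Function.onFun] at this ⊢
  rw [Basis.baseChange_apply, Basis.baseChange_apply, QuadraticForm.associated_baseChange,
    LinearMap.BilinForm.baseChange_tmul, this, zero_smul]

theorem isOrthoᵢ_weightedSumSquares {ι : Type*} [Fintype ι] [DecidableEq ι] (a : ι → k) :
    (associated (R := k) (weightedSumSquares k a)).IsOrthoᵢ (Pi.basisFun k ι) := by
  intro i j hij
  rw [Function.onFun, associated_apply, ← polar, polar_weightedSumSquares,
    diagBilin_apply, Finset.sum_eq_zero]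
  · simp
  · intro l _
    by_cases h : l = i
    · subst h
      simp [Pi.single_eq_of_ne hij]
    · simp [Pi.single_eq_of_ne h]

theorem equivalent_weightedSumSquares_of_isOrthoᵢ {M : Type*} [AddCommGroup M] [Module k M]
    {ι : Type*} [Fintype ι] {q : QuadraticForm k M} {b : Basis ι k M}
    (hb : (associated (R := k) q).IsOrthoᵢ b) :
    q.Equivalent (weightedSumSquares k fun i => q (b i)) := by
  rw [← basisRepr_eq_of_iIsOrtho q b hb]
  exact ⟨q.isometryEquivBasisRepr b⟩

theorem baseChange_equivalent {M N : Type*} [AddCommGroup M] [Module k M] [AddCommGroup N]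
    [Module k N] {q : QuadraticForm k M} {q' : QuadraticForm k N} (h : q.Equivalent q')
    (K : Type*) [Field K] [Algebra k K] :
    (q.baseChange K).Equivalent (q'.baseChange K) := by
  obtain ⟨e⟩ := h
  have h' : (q'.baseChange K).comp (e.toLinearEquiv.baseChange k K M N).toLinearMap =
      q.baseChange K := baseChange_ext fun m => by simp
  exact ⟨⟨e.toLinearEquiv.baseChange k K M N, fun x => congrArg (fun f => f x) h'⟩⟩

theorem baseChange_weightedSumSquares_equivalent {ι : Type*} [Fintype ι] (a : ι → k)
    (K : Type*) [Field K] [Algebra k K] :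
    (QuadraticForm.baseChange K (weightedSumSquares k a)).Equivalent
      (weightedSumSquares K fun i => algebraMap k K (a i)) := by
  classical
  let e := TensorProduct.piScalarRight k K K ι
  have h : (weightedSumSquares K fun i => algebraMap k K (a i)).comp e.toLinearMap =
      QuadraticForm.baseChange K (weightedSumSquares k a) := baseChange_ext fun m => by
    simp [e, Algebra.smul_def]
  exact ⟨⟨e, fun x => congrArg (fun f => f x) h⟩⟩

end TensorDiagonal

/-! ### Anisotropy of the form `φ` -/

section PhiForm

open QuadraticMap Module

variable {ℓ : Type u} [Field ℓ] {r : ℕ}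

/-- The diagonal entries of `⟨x_r + 1, -x_{r-1} - x_r, x_{r-1}, x_{r-1} x_r⟩ ⊗ ⟨⟨x_1, …, x_{r-2}⟩⟩`,
as polynomials. -/
def phiWeight (ℓ : Type u) [Field ℓ] (r : ℕ) (hr : 2 ≤ r) (p : Fin 4 × Finset (Fin (r - 2))) :
    MvPolynomial (Fin r) ℓ :=
  let y : MvPolynomial (Fin r) ℓ := MvPolynomial.X ⟨r - 2, by omega⟩
  let z : MvPolynomial (Fin r) ℓ := MvPolynomial.X ⟨r - 1, by omega⟩
  (![z + 1, -y - z, y, y * z] : Fin 4 → MvPolynomial (Fin r) ℓ) p.1 *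
    ∏ j ∈ p.2, MvPolynomial.X ⟨j, by omega⟩

/-- The exponents of the lowest terms of the `phiWeight`s. -/
def phiExponent (r : ℕ) (hr : 2 ≤ r) (p : Fin 4 × Finset (Fin (r - 2))) : Fin r →₀ ℕ :=
  let y : Fin r →₀ ℕ := Finsupp.single ⟨r - 2, by omega⟩ 1
  let z : Fin r →₀ ℕ := Finsupp.single ⟨r - 1, by omega⟩ 1
  (![0, z, y, y + z] : Fin 4 → Fin r →₀ ℕ) p.1 + ∑ j ∈ p.2, Finsupp.single ⟨j, by omega⟩ 1

open MvPowerSeries in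
theorem lexOrder_X (s : Fin r) :
    lexOrder (X s : MvPowerSeries (Fin r) ℓ) = toLex (Finsupp.single s 1) := by
  classical
  refine le_antisymm (lexOrder_le_of_coeff_ne_zero (by simp [coeff_X])) (le_lexOrder_iff.2 ?_)
  intro d hd
  rw [coeff_X, if_neg]
  rintro rfl
  exact lt_irrefl _ hd

open MvPowerSeries in
theorem lexOrder_eq_zero {f : MvPowerSeries (Fin r) ℓ} (hf : coeff 0 f ≠ 0) :
    lexOrder f = toLex (0 : Fin r →₀ ℕ) :=
  le_antisymm (lexOrder_le_of_coeff_ne_zero hf)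
    (le_lexOrder_iff.2 fun _ hd => absurd (WithTop.coe_lt_coe.1 hd) (not_lt_of_ge (zero_le)))

open MvPowerSeries in
theorem lexOrder_prod_X {ι : Type*} (S : Finset ι) (g : ι → Fin r) :
    lexOrder (∏ j ∈ S, X (g j) : MvPowerSeries (Fin r) ℓ) =
      toLex (∑ j ∈ S, Finsupp.single (g j) 1) := by
  classical
  induction S using Finset.induction_on with
  | empty => simpa using lexOrder_eq_zero (f := (1 : MvPowerSeries (Fin r) ℓ)) (by simp)
  | insert a S ha ih =>
    rw [Finset.prod_insert ha, Finset.sum_insert ha, lexOrder_mul, ih, lexOrder_X, toLex_add,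
      WithTop.coe_add]

open MvPowerSeries in
/-- The lexicographic order compares the exponents of `x_{r-1}` before those of `x_r`, so that
`-x_r` is the lowest term of `-x_{r-1} - x_r`. -/
theorem lexOrder_phiWeight (hr : 2 ≤ r) (p : Fin 4 × Finset (Fin (r - 2))) :
    lexOrder (phiWeight ℓ r hr p : MvPowerSeries (Fin r) ℓ) = toLex (phiExponent r hr p) := by
  classical
  obtain ⟨i, S⟩ := p
  have hprod : ((∏ j ∈ S, MvPolynomial.X ⟨j, by omega⟩ : MvPolynomial (Fin r) ℓ) :
      MvPowerSeries (Fin r) ℓ) = ∏ j ∈ S, X (⟨j, by omega⟩ : Fin r) := by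
    rw [← MvPolynomial.coeToMvPowerSeries.ringHom_apply, map_prod]
    simp [MvPolynomial.coeToMvPowerSeries.ringHom_apply]
  rw [phiWeight, phiExponent, MvPolynomial.coe_mul, lexOrder_mul, hprod,
    lexOrder_prod_X S fun j => (⟨j, by omega⟩ : Fin r), toLex_add, WithTop.coe_add]
  congr 1
  fin_cases i
  · refine lexOrder_eq_zero ?_
    simp
  · have hyz : (⟨r - 2, by omega⟩ : Fin r) < ⟨r - 1, by omega⟩ := by
      rw [Fin.mk_lt_mk]; omega
    have hlex := Finsupp.Lex.single_lt_iff.2 hyz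
    have hcoeff : ∀ d : Fin r →₀ ℕ, coeff d ((-MvPolynomial.X ⟨r - 2, by omega⟩ -
        MvPolynomial.X ⟨r - 1, by omega⟩ : MvPolynomial (Fin r) ℓ) : MvPowerSeries (Fin r) ℓ) =
        -(if d = Finsupp.single ⟨r - 2, by omega⟩ 1 then 1 else 0) -
          (if d = Finsupp.single ⟨r - 1, by omega⟩ 1 then 1 else 0) := fun d => by
      simp [MvPolynomial.coeff_coe, MvPolynomial.coeff_X, eq_comm]
    refine le_antisymm (lexOrder_le_of_coeff_ne_zero ?_) (le_lexOrder_iff.2 fun d hd => ?_)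
    · refine ne_of_eq_of_ne (hcoeff _) ?_
      rw [if_neg, if_pos (by rfl)]
      · simp
      · intro h
        have h' : (Finsupp.single ⟨r - 1, by omega⟩ 1 : Fin r →₀ ℕ) =
          Finsupp.single ⟨r - 2, by omega⟩ 1 := h
        rw [h'] at hlex
        exact lt_irrefl _ hlex
    · refine (hcoeff d).trans ?_
      have hd' := WithTop.coe_lt_coe.1 hd
      rw [if_neg, if_neg]
      · simp
      · rintro rfl
        exact lt_irrefl _ hd'
      · rintro rfl
        exact lt_asymm hlex hd'
  · simpa using lexOrder_X (ℓ := ℓ) (⟨r - 2, by omega⟩ : Fin r)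
  · simp only [Fin.reduceFinMk, Matrix.cons_val, MvPolynomial.coe_mul,
      MvPolynomial.coe_X, lexOrder_mul, lexOrder_X, toLex_add, WithTop.coe_add]

theorem phiExponent_y (hr : 2 ≤ r) (p : Fin 4 × Finset (Fin (r - 2))) :
    phiExponent r hr p ⟨r - 2, by omega⟩ = (![0, 0, 1, 1] : Fin 4 → ℕ) p.1 := by
  classical
  obtain ⟨i, S⟩ := p
  have hS : ∑ j ∈ S, (Finsupp.single (⟨j, by omega⟩ : Fin r) 1 : Fin r →₀ ℕ)
      ⟨r - 2, by omega⟩ = 0 :=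
    Finset.sum_eq_zero fun j _ => Finsupp.single_eq_of_ne (by
      have := j.2
      simp only [ne_eq, Fin.mk.injEq]; omega)
  have hzy : (⟨r - 2, by omega⟩ : Fin r) ≠ ⟨r - 1, by omega⟩ := by
    simp only [ne_eq, Fin.mk.injEq]; omega
  rw [phiExponent, Finsupp.add_apply, Finsupp.finsetSum_apply, hS, add_zero]
  fin_cases i <;> simp [Finsupp.single_eq_of_ne hzy]

theorem phiExponent_z (hr : 2 ≤ r) (p : Fin 4 × Finset (Fin (r - 2))) :
    phiExponent r hr p ⟨r - 1, by omega⟩ = (![0, 1, 0, 1] : Fin 4 → ℕ) p.1 := by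
  classical
  obtain ⟨i, S⟩ := p
  have hS : ∑ j ∈ S, (Finsupp.single (⟨j, by omega⟩ : Fin r) 1 : Fin r →₀ ℕ)
      ⟨r - 1, by omega⟩ = 0 :=
    Finset.sum_eq_zero fun j _ => Finsupp.single_eq_of_ne (by
      have := j.2
      simp only [ne_eq, Fin.mk.injEq]; omega)
  have hzy : (⟨r - 1, by omega⟩ : Fin r) ≠ ⟨r - 2, by omega⟩ := by
    simp only [ne_eq, Fin.mk.injEq]; omega
  rw [phiExponent, Finsupp.add_apply, Finsupp.finsetSum_apply, hS, add_zero]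
  fin_cases i <;> simp [Finsupp.single_eq_of_ne hzy]

theorem phiExponent_of_lt (hr : 2 ≤ r) (p : Fin 4 × Finset (Fin (r - 2))) (j : Fin (r - 2)) :
    phiExponent r hr p ⟨j, by omega⟩ = if j ∈ p.2 then 1 else 0 := by
  classical
  obtain ⟨i, S⟩ := p
  have hj := j.2
  have hz : (⟨j, by omega⟩ : Fin r) ≠ ⟨r - 1, by omega⟩ := by
    simp only [ne_eq, Fin.mk.injEq]; omega
  have hy : (⟨j, by omega⟩ : Fin r) ≠ ⟨r - 2, by omega⟩ := by
    simp only [ne_eq, Fin.mk.injEq]; omega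
  have hS : ∑ l ∈ S, (Finsupp.single (⟨l, by omega⟩ : Fin r) 1 : Fin r →₀ ℕ) ⟨j, by omega⟩ =
      if j ∈ S then 1 else 0 := by
    rw [← Finset.sum_ite_eq' S j fun _ => 1]
    refine Finset.sum_congr rfl fun l _ => ?_
    simp [Finsupp.single_apply, Fin.ext_iff]
  rw [phiExponent, Finsupp.add_apply, Finsupp.finsetSum_apply, hS]
  fin_cases i <;> simp [Finsupp.single_eq_of_ne hz, Finsupp.single_eq_of_ne hy]

/-- The exponents of the lowest terms are pairwise distinct modulo two: the parities of the
exponents of `x_{r-1}` and `x_r` tell the four entries of the first factor apart, and those of the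
other variables recover the subset `S`. -/
theorem phiExponent_injective_mod_two (hr : 2 ≤ r) (p p' : Fin 4 × Finset (Fin (r - 2)))
    (m m' : Fin r →₀ ℕ) (h : phiExponent r hr p + (m + m) = phiExponent r hr p' + (m' + m')) :
    p = p' := by
  have hy := DFunLike.congr_fun h ⟨r - 2, by omega⟩
  have hz := DFunLike.congr_fun h ⟨r - 1, by omega⟩
  simp only [Finsupp.add_apply, phiExponent_y, phiExponent_z] at hy hz
  have h2 : p.2 = p'.2 := by
    ext j
    have hj := DFunLike.congr_fun h ⟨j, by omega⟩
    simp only [Finsupp.add_apply, phiExponent_of_lt] at hj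
    split_ifs at hj with h1 h2 h2
    · simp [h1, h2]
    · omega
    · omega
    · simp [h1, h2]
  have h1 : p.1 = p'.1 := by
    obtain ⟨i, S⟩ := p
    obtain ⟨i', S'⟩ := p'
    fin_cases i <;> fin_cases i' <;> simp at hy hz ⊢ <;> omega
  exact Prod.ext h1 h2

variable [Invertible (2 : ℓ)]

/-- A diagonalization of `q` diagonalizes `φ`. -/
theorem phiForm_equivalent (hr : 2 ≤ r) {d : ℕ} (q : QuadraticForm ℓ (Fin d → ℓ))
    {ι : Type*} [Fintype ι] {b : Basis ι ℓ (Fin d → ℓ)}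
    (hb : (associated (R := ℓ) q).IsOrthoᵢ b) :
    (phiForm ℓ r hr q).Equivalent (weightedSumSquares (RatField ℓ r)
      fun p : Fin 4 × (ι × Finset (Fin (r - 2))) =>
        algebraMap (MvPolynomial (Fin r) ℓ) (RatField ℓ r)
          (phiWeight ℓ r hr (p.1, p.2.2) * MvPolynomial.C (q (b p.2.1)))) := by
  classical
  have h := equivalent_weightedSumSquares_of_isOrthoᵢ (q := phiForm ℓ r hr q)
    (isOrthoᵢ_tmul (isOrthoᵢ_weightedSumSquares _)
      (isOrthoᵢ_tmul (isOrthoᵢ_baseChange hb (RatField ℓ r)) (isOrthoᵢ_weightedSumSquares _)))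
  refine h.trans ⟨QuadraticForm.weightedSumSquaresCongr (funext fun ⟨i, j, S⟩ => ?_)⟩
  rw [Basis.tensorProduct_apply, Basis.tensorProduct_apply, phiForm,
    QuadraticForm.tensorDistrib_tmul, QuadraticForm.tensorDistrib_tmul, Basis.baseChange_apply,
    QuadraticForm.baseChange_tmul, weightedSumSquares_basisFun, pfisterForm,
    weightedSumSquares_basisFun, phiWeight]
  have hC : algebraMap (MvPolynomial (Fin r) ℓ) (RatField ℓ r) (MvPolynomial.C (q (b j))) =
      algebraMap ℓ (RatField ℓ r) (q (b j)) := by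
    rw [IsScalarTower.algebraMap_apply ℓ (MvPolynomial (Fin r) ℓ) (RatField ℓ r)]
    rfl
  simp only [map_mul, map_prod, hC, smul_eq_mul, mul_one, Algebra.smul_def, ratVar]
  fin_cases i <;> simp <;> ring

/-- Globally `φ` is anisotropic: it is the orthogonal sum of the multiples of `q` by the
`phiWeight`s, whose lowest terms are distinct modulo squares. -/
theorem anisotropic_phiForm (hr : 2 ≤ r) {d : ℕ} (q : QuadraticForm ℓ (Fin d → ℓ))
    (hq : q.Anisotropic) : (phiForm ℓ r hr q).Anisotropic := by
  obtain ⟨b, hb⟩ := LinearMap.BilinForm.exists_orthogonal_basis (B := associated (R := ℓ) q)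
    ⟨associated_isSymm ℓ q⟩
  refine anisotropic_of_equivalent (phiForm_equivalent hr q hb).symm fun x hx => ?_
  have hc : ∀ y : Fin (finrank ℓ (Fin d → ℓ)) → ℓ, ∑ i, q (b i) * y i ^ 2 = 0 → y = 0 := fun y hy =>
    anisotropic_of_equivalent (equivalent_weightedSumSquares_of_isOrthoᵢ hb) hq y
      (by simpa [pow_two] using hy)
  have h0 := eq_zero_of_sum_weights_mul_sq_fractionRing hc (lexOrder_phiWeight hr)
    (phiExponent_injective_mod_two hr) (F := RatField ℓ r)
    (y := fun a i => x (a.1, (i, a.2))) (by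
      rw [← hx, weightedSumSquares_apply]
      simp only [Fintype.sum_prod_type, Finset.mul_sum, map_mul, smul_eq_mul]
      refine Finset.sum_congr rfl fun i _ => ?_
      rw [Finset.sum_comm]
      refine Finset.sum_congr rfl fun j _ => Finset.sum_congr rfl fun S _ => ?_
      ring)
  ext ⟨i, j, S⟩
  exact congrFun (congrFun h0 (i, S)) j

end PhiForm

/-! ### The four-dimensional factor over the completion -/

section LocalIsotropy

open QuadraticMap Module

variable {k : Type u} [Field k] (v : Valuation k ℤᵐ⁰)

/-- An isotropic line in one factor of a tensor product of diagonal forms, tensored with the other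
factor, is totally isotropic. -/
theorem exists_isotropic_subspace_of_isotropic_factor {K : Type*} [Field K] {A κ : Type*}
    [Fintype A] [Fintype κ] (w : A → K) (c : κ → K) {s : A → K} (hs0 : s ≠ 0)
    (hs : ∑ i, w i * s i ^ 2 = 0) :
    ∃ W : Submodule K (A × κ → K),
      (∀ x ∈ W, weightedSumSquares K (fun p : A × κ => w p.1 * c p.2) x = 0) ∧
      finrank K W = Fintype.card κ := by
  let f : (κ → K) →ₗ[K] (A × κ → K) :=
    { toFun := fun t p => s p.1 * t p.2
      map_add' := fun t t' => by ext p; simp [mul_add]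
      map_smul' := fun b t => by ext p; simp; ring }
  obtain ⟨i, hi⟩ := Function.ne_iff.1 hs0
  have hf : Function.Injective f := by
    intro t t' h
    ext j
    exact mul_left_cancel₀ hi (congrFun h (i, j))
  refine ⟨LinearMap.range f, ?_, ?_⟩
  · rintro _ ⟨t, rfl⟩
    have : weightedSumSquares K (fun p : A × κ => w p.1 * c p.2) (f t) =
        (∑ i, w i * s i ^ 2) * ∑ j, c j * t j ^ 2 := by
      rw [weightedSumSquares_apply, Fintype.sum_prod_type, Finset.sum_mul_sum]
      refine Finset.sum_congr rfl fun i _ => Finset.sum_congr rfl fun j _ => ?_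
      simp only [f, LinearMap.coe_mk, AddHom.coe_mk, smul_eq_mul]
      ring
    rw [this, hs, zero_mul]
  · rw [LinearMap.finrank_range_of_inj hf, finrank_pi]

theorem exists_sq_eq_of_map_sub_one_lt (h2 : v 2 = 1) {a : k} (ha : v (a - 1) < 1) :
    ∃ s : v.Completion, s ^ 2 = algebraMap k v.Completion a := by
  obtain ⟨s, hs⟩ := exists_sq_eq_one_add v h2 ha
  exact ⟨s, by rw [hs, add_sub_cancel]⟩

/-- At a place where `y` and `y - 1` are units, the form `⟨z + 1, -y - z, y, yz⟩` has unit entries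
or becomes isotropic over the completion. -/
theorem units_or_isotropic (h2 : v 2 = 1) {y z : k} (hy : v y = 1) (hy1 : v (y - 1) = 1) :
    (∀ i, v ((![z + 1, -y - z, y, y * z] : Fin 4 → k) i) = 1) ∨
      ∃ s : Fin 4 → v.Completion, s ≠ 0 ∧
        ∑ i, algebraMap k v.Completion ((![z + 1, -y - z, y, y * z] : Fin 4 → k) i) * s i ^ 2
          = 0 := by
  have hy0 : y ≠ 0 := by rintro rfl; simp at hy
  by_cases hz1 : v (z + 1) < 1
  · -- here `-z` is a square, and `⟨y, yz⟩` is hyperbolic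
    right
    obtain ⟨s, hs⟩ := exists_sq_eq_of_map_sub_one_lt v h2 (a := -z) (by
      rwa [show -z - 1 = -(z + 1) by ring, Valuation.map_neg])
    refine ⟨![0, 0, s, 1], fun h => one_ne_zero (congrFun h 3), ?_⟩
    simp [Fin.sum_univ_four, hs]
  by_cases hz0 : v z < 1
  · -- here `1 + z / y` is a square, and `⟨-y - z, y⟩` is hyperbolic
    right
    obtain ⟨s, hs⟩ := exists_sq_eq_of_map_sub_one_lt v h2 (a := (y + z) / y) (by
      rw [show (y + z) / y - 1 = z / y by field_simp; ring, map_div₀, hy, div_one]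
      exact hz0)
    refine ⟨![0, 1, s, 0], fun h => one_ne_zero (congrFun h 1), ?_⟩
    have : algebraMap k v.Completion y ≠ 0 := (map_ne_zero _).2 hy0
    simp [Fin.sum_univ_four, hs]
    field_simp
    ring
  by_cases hyz : v (y + z) < 1
  · -- here `z + 1 + y` and `-z / y` are congruent to `1`, so their quotient is a square, and
    -- `⟨z + 1, y⟩` and `⟨yz⟩ ≃ ⟨z / y⟩` represent opposite values
    right
    have hz : v z = 1 := by
      have := Valuation.map_sub_eq_of_lt_right v (x := y + z) (y := y) (by rwa [hy])
      rwa [add_sub_cancel_left, hy] at this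
    have hz0' : z ≠ 0 := by rintro rfl; simp at hz
    obtain ⟨s, hs⟩ := exists_sq_eq_of_map_sub_one_lt v h2 (a := (1 + z + y) * y / (-z)) (by
      rw [show (1 + z + y) * y / (-z) - 1 = -((y + z) * (1 + y) / z) by field_simp; ring,
        Valuation.map_neg, map_div₀, map_mul, hz, div_one]
      refine mul_lt_one_of_lt_of_le hyz ?_
      exact (Valuation.map_add _ _ _).trans (by simp [hy]))
    have h1 : algebraMap k v.Completion y ≠ 0 := (map_ne_zero _).2 hy0
    have h3 : algebraMap k v.Completion z ≠ 0 := (map_ne_zero _).2 hz0'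
    refine ⟨![1, 0, 1, s / algebraMap k v.Completion y], fun h => one_ne_zero (congrFun h 0), ?_⟩
    simp [Fin.sum_univ_four, div_pow, hs]
    field_simp
    ring
  by_cases hz : 1 < v z
  · -- here `(y + z) / (z + 1)` is a square, and `⟨z + 1, -y - z⟩` is hyperbolic
    right
    have hz1' : v (z + 1) = v z := Valuation.map_add_eq_of_lt_left v (by simpa using hz)
    have hz10 : z + 1 ≠ 0 := by
      intro h
      rw [h, map_zero] at hz1'
      exact not_lt_zero (hz1' ▸ hz)
    obtain ⟨s, hs⟩ := exists_sq_eq_of_map_sub_one_lt v h2 (a := (y + z) / (z + 1)) (by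
      rw [show (y + z) / (z + 1) - 1 = (y - 1) / (z + 1) by field_simp; ring, map_div₀, hy1, hz1']
      exact (div_lt_one₀ (zero_lt_one.trans hz)).2 hz)
    have h1 : algebraMap k v.Completion z + 1 ≠ 0 := by
      have := (map_ne_zero (algebraMap k v.Completion)).2 hz10
      rwa [map_add, map_one] at this
    refine ⟨![s, 1, 0, 0], fun h => one_ne_zero (congrFun h 1), ?_⟩
    simp [Fin.sum_univ_four, hs]
    field_simp
    ring
  · left
    have hz' : v z = 1 := le_antisymm (not_lt.1 hz) (not_lt.1 hz0)
    have hle : ∀ a b, v a = 1 → v b = 1 → ¬ v (a + b) < 1 → v (a + b) = 1 := fun a b ha hb hab =>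
      le_antisymm ((Valuation.map_add _ _ _).trans (by simp [ha, hb])) (not_lt.1 hab)
    intro i
    fin_cases i
    · exact hle z 1 hz' (map_one v) hz1
    · change v (-y - z) = 1
      rw [show -y - z = -(y + z) by ring, Valuation.map_neg]
      exact hle y z hy hz' hyz
    · exact hy
    · change v (y * z) = 1
      rw [map_mul, hy, hz', one_mul]

end LocalIsotropy

/-! ### Subforms of small codimension -/

section Subforms

open QuadraticMap Module

variable {k : Type u} [Field k] [Invertible (2 : k)]

/-- A nondegenerate form that embeds with codimension `n` in a diagonal form loses at most `n` of
the dimension of a totally isotropic subspace over an extension field. -/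
theorem le_wittIndex_baseChange_of_isometry {d : ℕ} {ψ : QuadraticForm k (Fin d → k)}
    (hψ : ψ.Nondegenerate) {ι : Type*} [Fintype ι] {a : ι → k}
    (f : ψ →qᵢ weightedSumSquares k a) (K : Type*) [Field K] [Algebra k K]
    {W : Submodule K (ι → K)}
    (hW : ∀ x ∈ W, weightedSumSquares K (fun i => algebraMap k K (a i)) x = 0) {m n : ℕ}
    (hm : finrank K W = m) (hd : Fintype.card ι ≤ d + n) :
    m - n ≤ wittIndex (ψ.baseChange K) := by
  classical
  let _ : Invertible (2 : K) := (Invertible.map (algebraMap k K) 2).copy 2 (map_ofNat _ _).symm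
  have hnd : (ψ.baseChange K).Nondegenerate := by
    obtain ⟨b, hb0, hb⟩ := exists_equivalent_weightedSumSquares hψ
    exact Nondegenerate.of_equivalent ((baseChange_equivalent hb K).trans
      (baseChange_weightedSumSquares_equivalent b K)).symm
      (nondegenerate_weightedSumSquares fun i => (map_ne_zero _).2 (hb0 i))
  let g : K ⊗[k] (Fin d → k) →ₗ[K] (ι → K) :=
    (TensorProduct.piScalarRight k K K ι).toLinearMap ∘ₗ f.toLinearMap.baseChange K
  have hg : (weightedSumSquares K fun i => algebraMap k K (a i)).comp g = ψ.baseChange K :=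
    baseChange_ext fun x => by
      rw [QuadraticForm.baseChange_tmul, ← f.map_app]
      simp [-Isometry.map_app, g, Algebra.smul_def]
  let g' : ψ.baseChange K →qᵢ weightedSumSquares K fun i => algebraMap k K (a i) :=
    ⟨g, fun x => congrArg (fun q => q x) hg⟩
  have hinj : Function.Injective g := isometry_injective hnd g'
  refine le_wittIndex_of_isotropic hnd (W := W.comap g)
    (fun x hx => (g'.map_app x).symm.trans (hW _ hx)) ?_
  have h1 : finrank K (W.comap g) = finrank K (LinearMap.range g ⊓ W : Submodule K (ι → K)) := by
    rw [← Submodule.map_comap_eq]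
    exact (LinearEquiv.finrank_eq (Submodule.equivMapOfInjective g hinj _))
  have h2 := Submodule.finrank_sup_add_finrank_inf_eq (LinearMap.range g) W
  have h3 := Submodule.finrank_le (LinearMap.range g ⊔ W)
  rw [LinearMap.finrank_range_of_inj hinj, finrank_baseChange, finrank_pi, Fintype.card_fin,
    hm] at h2
  rw [finrank_pi] at h3
  omega

end Subforms

/-! ### The form `φ` over the completions -/

section LocalPhiForm

open QuadraticMap Module

variable {ℓ : Type u} [Field ℓ] [Invertible (2 : ℓ)]

/-- At each place of `V_r` the form `φ` has a totally isotropic subspace of dimension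
`2 ^ (i + r - 2)`. If the four-dimensional factor is isotropic over the completion, this is an
isotropic line of that factor tensored with the other factors. Otherwise all entries are units, and
the reduction of `φ`, of dimension `2 ^ (i + r)`, has such a subspace because forms over the residue
field in more than `2 ^ (i + r - 1)` variables are isotropic. -/
theorem exists_isotropic_subspace_phiForm_completion {i : ℕ} (hA : PropertyA2 ℓ i) {r : ℕ}
    (hr : 2 ≤ r) {ι : Type*} [Fintype ι] (hι : Fintype.card ι = 2 ^ i) {c : ι → ℓ}
    (hc : ∀ j, c j ≠ 0) {v : Valuation (RatField ℓ r) ℤᵐ⁰} (hv : v ∈ valuationSet ℓ r) :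
    ∃ W : Submodule v.Completion (Fin 4 × (ι × Finset (Fin (r - 2))) → v.Completion),
      (∀ x ∈ W, weightedSumSquares v.Completion
        (fun p => algebraMap (RatField ℓ r) v.Completion
          (algebraMap (MvPolynomial (Fin r) ℓ) (RatField ℓ r)
            (phiWeight ℓ r hr (p.1, p.2.2) * MvPolynomial.C (c p.2.1)))) x = 0) ∧
      finrank v.Completion W = 2 ^ (i + r - 2) := by
  obtain ⟨hnt, htriv⟩ := hv
  have hconst : ∀ b : ℓ, b ≠ 0 → v (algebraMap ℓ (RatField ℓ r) b) = 1 := fun b hb =>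
    htriv _ ((ratSubfield ℓ r).algebraMap_mem b) ((map_ne_zero _).2 hb)
  have hvarmem : ∀ j : Fin r, (j : ℕ) < r - 1 → ratVar ℓ r j ∈ ratSubfield ℓ r := fun j hj =>
    IntermediateField.subset_adjoin _ _ ⟨j, hj, rfl⟩
  have hX : ∀ p : MvPolynomial (Fin r) ℓ, p ≠ 0 → algebraMap _ (RatField ℓ r) p ≠ 0 := fun p hp =>
    (map_ne_zero_iff _ (IsFractionRing.injective (MvPolynomial (Fin r) ℓ) (RatField ℓ r))).2 hp
  have hvar : ∀ j : Fin r, (j : ℕ) < r - 1 → v (ratVar ℓ r j) = 1 := fun j hj =>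
    htriv _ (hvarmem j hj) (hX _ (MvPolynomial.X_ne_zero j))
  have h2 : v 2 = 1 := by
    rw [← map_ofNat (algebraMap ℓ (RatField ℓ r)) 2]
    exact hconst 2 (Invertible.ne_zero 2)
  set y := ratVar ℓ r ⟨r - 2, by omega⟩ with hy
  set z := ratVar ℓ r ⟨r - 1, by omega⟩ with hz
  have hvy : v y = 1 := hvar _ (by simp; omega)
  have hvy1 : v (y - 1) = 1 := by
    refine htriv _ ((ratSubfield ℓ r).sub_mem (hvarmem _ (by simp; omega)) (one_mem _)) ?_
    have := hX (MvPolynomial.X ⟨r - 2, by omega⟩ - 1) (fun h => by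
      have := congrArg (MvPolynomial.coeff 0) h
      simp [MvPolynomial.coeff_zero_X] at this)
    rwa [map_sub, map_one] at this
  let κ := ι × Finset (Fin (r - 2))
  let w : Fin 4 → RatField ℓ r := ![z + 1, -y - z, y, y * z]
  let c' : κ → RatField ℓ r := fun p =>
    (∏ j ∈ p.2, ratVar ℓ r ⟨j, by omega⟩) * algebraMap ℓ (RatField ℓ r) (c p.1)
  have hc' : ∀ p, v (c' p) = 1 := fun p => by
    rw [map_mul, hconst _ (hc _), mul_one, map_prod]
    exact Finset.prod_eq_one fun j _ => hvar _ (by have := j.2; simp; omega)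
  have hweight : ∀ p : Fin 4 × κ, algebraMap (MvPolynomial (Fin r) ℓ) (RatField ℓ r)
      (phiWeight ℓ r hr (p.1, p.2.2) * MvPolynomial.C (c p.2.1)) = w p.1 * c' p.2 := by
    rintro ⟨i, j, S⟩
    have hC : algebraMap (MvPolynomial (Fin r) ℓ) (RatField ℓ r) (MvPolynomial.C (c j)) =
        algebraMap ℓ (RatField ℓ r) (c j) := by
      rw [IsScalarTower.algebraMap_apply ℓ (MvPolynomial (Fin r) ℓ) (RatField ℓ r)]
      rfl
    simp only [phiWeight, map_mul, map_prod, hC, w, c', hy, hz, ratVar, mul_assoc]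
    congr 1
    fin_cases i <;> simp
  simp only [hweight]
  have hcard : Fintype.card κ = 2 ^ (i + r - 2) := by
    simp only [κ, Fintype.card_prod, hι, Fintype.card_finset, Fintype.card_fin, ← pow_add]
    congr 1
    omega
  rcases units_or_isotropic v h2 hvy hvy1 with hunit | ⟨s, hs0, hs⟩
  · have hF := isotropicAbove_ratField hA r
    rw [show 2 ^ (i + r) = 2 * 2 ^ (i + r - 1) by rw [← pow_succ']; congr 1; omega] at hF
    refine exists_isotropic_subspace_completion v h2 (isotropicAbove_resField v hnt hF) ?_
      (fun p : Fin 4 × κ => w p.1 * c' p.2) fun p => by rw [map_mul, hunit, hc', one_mul]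
    rw [Fintype.card_prod, hcard, Fintype.card_fin,
      show i + r - 1 = (i + r - 2) + 1 by omega, pow_succ]
    omega
  · rw [← hcard]
    simp only [map_mul]
    exact exists_isotropic_subspace_of_isotropic_factor
      (fun i => algebraMap (RatField ℓ r) v.Completion (w i))
      (fun j => algebraMap (RatField ℓ r) v.Completion (c' j)) hs0 hs

end LocalPhiForm

/-! ### Failure of the local-global principle -/

section Violation

open QuadraticMap Module

theorem exists_anisotropic_of_uInvariant_eq {k : Type u} [Field k] {d : ℕ} (hd : 0 < d)
    (hu : uInvariant k = d) : ∃ q : QuadraticForm k (Fin d → k), q.Anisotropic := by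
  by_contra! hcon
  have hle : uInvariant k ≤ ((d - 1 : ℕ) : ℕ∞) := by
    refine iSup₂_le fun n hn => ?_
    obtain ⟨q, hq⟩ := hn
    have h1 : (n : ℕ∞) ≤ uInvariant k :=
      le_iSup₂ (f := fun (n : ℕ) (_ : n ∈ {n : ℕ | ∃ q : QuadraticForm k (Fin n → k),
        q.Anisotropic}) => (n : ℕ∞)) n ⟨q, hq⟩
    rw [hu, Nat.cast_le] at h1
    have h2 : n ≠ d := by
      rintro rfl
      exact hcon q hq
    rw [Nat.cast_le]
    omega
  rw [hu, Nat.cast_le] at hle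
  omega

theorem finrank_phiForm {ℓ : Type u} [Field ℓ] {i r : ℕ} (hr : 2 ≤ r) :
    finrank (RatField ℓ r) ((Fin 4 → RatField ℓ r) ⊗[RatField ℓ r]
      ((RatField ℓ r ⊗[ℓ] (Fin (2 ^ i) → ℓ)) ⊗[RatField ℓ r]
        (Finset (Fin (r - 2)) → RatField ℓ r))) = 2 ^ (i + r) := by
  rw [finrank_tensorProduct, finrank_tensorProduct, finrank_baseChange]
  simp only [finrank_pi, Fintype.card_fin, Fintype.card_finset]
  rw [show 4 = 2 ^ 2 by rfl, ← pow_add, ← pow_add]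
  congr 1
  omega

/-- Every subform of `φ` is anisotropic, and its codimension `n` bounds the loss in the Witt
index at the places of `V_r`. -/
theorem not_satisfiesLGP_of_isSubform {ℓ : Type u} [Field ℓ] [Invertible (2 : ℓ)] {i : ℕ}
    (hA : PropertyA2 ℓ i) {r : ℕ} (hr : 2 ≤ r) {n : ℕ}
    (q : QuadraticForm ℓ (Fin (2 ^ i) → ℓ)) (hq : q.Anisotropic)
    (ψ : QuadraticForm (RatField ℓ r) (Fin (2 ^ (i + r) - n) → RatField ℓ r))
    (hψ : IsSubform ψ (phiForm ℓ r hr q)) :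
    ¬ SatisfiesLGP (valuationSet ℓ r) ψ (2 ^ (i + r - 2) - n) 1 := by
  obtain ⟨n', ψ', ⟨e⟩⟩ := hψ
  have hψa : ψ.Anisotropic := fun x hx => by
    have h := anisotropic_of_equivalent ⟨e⟩ (anisotropic_phiForm hr q hq) (x, 0) (by simp [hx])
    exact congrArg Prod.fst h
  intro h
  have h0 := wittIndex_eq_zero_of_anisotropic hψa
  -- it remains to bound the Witt index of `ψ` over each completion
  refine absurd (h fun v hv => ?_) (by omega)
  obtain ⟨b, hb⟩ := LinearMap.BilinForm.exists_orthogonal_basis (B := associated (R := ℓ) q)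
    ⟨associated_isSymm ℓ q⟩
  obtain ⟨e'⟩ := phiForm_equivalent hr q hb
  obtain ⟨W, hW, hWdim⟩ := exists_isotropic_subspace_phiForm_completion hA hr
    (ι := Fin (finrank ℓ (Fin (2 ^ i) → ℓ))) (c := fun j => q (b j)) (by simp)
    (fun j hj => b.ne_zero j (hq _ hj)) hv
  refine le_wittIndex_baseChange_of_isometry (Nondegenerate.of_anisotropic hψa)
    ((e'.toIsometry.comp e.symm.toIsometry).comp (QuadraticMap.Isometry.inl ψ ψ'))
    v.Completion hW hWdim ?_
  simp only [Fintype.card_prod, Fintype.card_fin, Fintype.card_finset, finrank_pi]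
  rw [show 4 = 2 ^ 2 by rfl, ← pow_add, ← pow_add, show 2 + (i + (r - 2)) = i + r by omega]
  omega

/-- An anisotropic form has nondegenerate subforms of each dimension up to its own. -/
theorem exists_isSubform_of_le {k : Type u} [Field k] [Invertible (2 : k)] {V : Type*}
    [AddCommGroup V] [Module k V] [FiniteDimensional k V] {φ : QuadraticForm k V}
    (hφ : φ.Anisotropic) {m : ℕ} (hm : m ≤ finrank k V) :
    ∃ ψ : QuadraticForm k (Fin m → k), IsRegular ψ ∧ IsSubform ψ φ := by
  let b := Module.finBasis k V
  let f : (Fin m → k) →ₗ[k] V := Fintype.linearCombination k fun j => b (Fin.castLE hm j)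
  have hf : Function.Injective f := by
    have := b.linearIndependent.comp _ (Fin.castLE_injective hm)
    exact this.fintypeLinearCombination_injective
  have ha : (φ.comp f).Anisotropic := fun x hx => (map_eq_zero_iff f hf).1 (hφ _ hx)
  have hnd := Nondegenerate.of_anisotropic ha
  exact ⟨φ.comp f, hnd, isSubform_of_isometry hnd ⟨f, fun _ => rfl⟩⟩

end Violation

end LGP

end

theorem mainTheorem1 {ℓ : Type u} [Field ℓ] [Invertible (2 : ℓ)] (i : ℕ)
    (hA : LGP.PropertyA2 ℓ i) (hu : LGP.uInvariant ℓ = ((2 ^ i : ℕ) : ℕ∞))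
    (r : ℕ) (hr : 2 ≤ r) (n : ℕ) (hn : n < 2 ^ (i + r - 2)) :
    (∃ q : QuadraticForm ℓ (Fin (2 ^ i) → ℓ), q.Anisotropic ∧
      ∃ ψ : QuadraticForm (LGP.RatField ℓ r) (Fin (2 ^ (i + r) - n) → LGP.RatField ℓ r),
        LGP.IsRegular ψ ∧ LGP.IsSubform ψ (LGP.phiForm ℓ r hr q) ∧
        ¬ LGP.SatisfiesLGP (LGP.valuationSet ℓ r) ψ (2 ^ (i + r - 2) - n) 1) ∧
    (∀ q : QuadraticForm ℓ (Fin (2 ^ i) → ℓ), q.Anisotropic →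
      ∀ ψ : QuadraticForm (LGP.RatField ℓ r) (Fin (2 ^ (i + r) - n) → LGP.RatField ℓ r),
        LGP.IsSubform ψ (LGP.phiForm ℓ r hr q) →
        ¬ LGP.SatisfiesLGP (LGP.valuationSet ℓ r) ψ (2 ^ (i + r - 2) - n) 1) := by
  refine ⟨?_, fun q hq ψ hψ => LGP.not_satisfiesLGP_of_isSubform hA hr q hq ψ hψ⟩
  obtain ⟨q, hq⟩ := LGP.exists_anisotropic_of_uInvariant_eq (pow_pos two_pos i) hu
  obtain ⟨ψ, hreg, hψ⟩ := LGP.exists_isSubform_of_le (LGP.anisotropic_phiForm hr q hq)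
    (m := 2 ^ (i + r) - n) (by rw [LGP.finrank_phiForm hr]; exact Nat.sub_le _ _)
  exact ⟨q, hq, ψ, hreg, hψ, LGP.not_satisfiesLGP_of_isSubform hA hr q hq ψ hψ⟩
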